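/- Fix $\sigma>0$ and $\alpha>0$. For a real $m\times n$ matrix $A$ let $$C_n(A)=\log 2-\frac{m}{2n}-\frac1n\,\mathbb E_Y\log\Big\{\sum_{x\in\{+1,-1\}^n}e^{-\frac{1}{2\sigma^2}\|Y-Ax\|_2^2}\Big\},\qquad Y=AX+\sigma Z,$$ where $X$ is uniform on $\{+1,-1\}^n$ and $Z$ is a vector of $m$ i.i.d. $N(0,1)$ variables independent of $X$; this is the per-user capacity (in nats) of the Gaussian CDMA channel with spreading matrix $A$, noise power $\sigma^2$ and uniform antipodal inputs. A sequence of random $m\times n$ matrices, with $n\to\infty$ and $m$ depending on $n$, is of standard type if each matrix has i.i.d. entries $A_{ij}$ with $\mathbb E[A_{ij}]=0$, $\mathbb E[A_{ij}^2]=1$ and $\mathbb E[A_{ij}^6]\le K<\infty$, where $K$ does not depend on $m,n$. Theorem. Let $\mathbf A_n$ and $\mathbf B_n$ be two sequences of $m\times n$ random matrices of standard type (possibly with different entry distributions). Then $C_n(m^{-1/2}\mathbf A_n)$ and $C_n(m^{-1/2}\mathbf B_n)$ are integrable, and $$\mathbb E[C_n(m^{-1/2}\mathbf A_n)]-\mathbb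 E[C_n(m^{-1/2}\mathbf B_n)]\longrightarrow 0$$ as $n\to\infty$ with $m/n\to\alpha$, along any sequence of pairs $(m,n)$; in particular this holds as $n\to\infty$ with $m=\alpha n$. -/

import Mathlib

open MeasureTheory ProbabilityTheory Filter Topology
open scoped Matrix ENNReal

noncomputable section

namespace CDMA

/-- The real vector in `{+1, -1}^n` given by a choice of signs (`ℤˣ = {1, -1}`). -/
def symbols {n : ℕ} (x : Fin n → ℤˣ) : Fin n → ℝ := fun j => ((x j : ℤ) : ℝ)

/-- Law of the received signal `Y = A X + σ Z`, where `X` is uniform on `{+1, -1}^n` and `Z`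
is independent of `X` with i.i.d. standard Gaussian entries: the uniform mixture over
the inputs `x` of the laws of `A x + σ Z`. -/
def outputLaw {m n : ℕ} (σ : ℝ) (A : Matrix (Fin m) (Fin n) ℝ) : Measure (Fin m → ℝ) :=
  ((2 : ℝ≥0∞) ^ n)⁻¹ • ∑ x : Fin n → ℤˣ,
    (Measure.pi fun _ : Fin m => gaussianReal 0 1).map fun z => A *ᵥ symbols x + σ • z

/-- `log ∑_{x ∈ {+1,-1}^n} exp (-‖y - A x‖₂² / (2σ²))`. -/
def logPartition {m n : ℕ} (σ : ℝ) (A : Matrix (Fin m) (Fin n) ℝ) (y : Fin m → ℝ) : ℝ :=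
  Real.log (∑ x : Fin n → ℤˣ,
    Real.exp (-(1 / (2 * σ ^ 2)) * ∑ i, (y i - (A *ᵥ symbols x) i) ^ 2))

/-- Per-user capacity (in nats) of the antipodal-input Gaussian CDMA channel with `m × n`
spreading matrix `A` and noise power `σ²`:
`log 2 - α/2 - n⁻¹ E_Y log ∑_x exp (-‖Y - A x‖₂² / (2σ²))` with `α = m / n`. -/
def capacity {m n : ℕ} (σ : ℝ) (A : Matrix (Fin m) (Fin n) ℝ) : ℝ :=
  Real.log 2 - (1 / 2) * ((m : ℝ) / n) - (1 / n) * ∫ y, logPartition σ A y ∂(outputLaw σ A)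

/-- A sequence of random matrices, the `k`-th one of size `m k × n k`, is of standard type:
for every `k` the entries are i.i.d. with mean `0`, second moment `1` and sixth
moment at most `K`, where `K` does not depend on `k`. -/
structure IsStandardType {m n : ℕ → ℕ} {Ω : ℕ → Type*} [∀ k, MeasurableSpace (Ω k)]
    (P : ∀ k, Measure (Ω k)) (A : ∀ k, Ω k → Matrix (Fin (m k)) (Fin (n k)) ℝ) : Prop where
  measurable : ∀ k i j, Measurable fun ω => A k ω i j
  indep : ∀ k, iIndepFun (fun (p : Fin (m k) × Fin (n k)) ω => A k ω p.1 p.2) (P k)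
  ident : ∀ k i j i' j',
    IdentDistrib (fun ω => A k ω i j) (fun ω => A k ω i' j') (P k) (P k)
  mean_zero : ∀ k i j, ∫ ω, A k ω i j ∂(P k) = 0
  second_moment : ∀ k i j, ∫ ω, (A k ω i j) ^ 2 ∂(P k) = 1
  sixth_moment : ∃ K : ℝ, ∀ k i j, Integrable (fun ω => (A k ω i j) ^ 6) (P k) ∧
    ∫ ω, (A k ω i j) ^ 6 ∂(P k) ≤ K

/-- The expectation over the received signal in `capacity` is a genuine one. -/
theorem integrable_logPartition {m n : ℕ} {σ : ℝ} (hσ : 0 < σ)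
    (A : Matrix (Fin m) (Fin n) ℝ) : Integrable (logPartition σ A) (outputLaw σ A) := by
  have hcont : Continuous (logPartition σ A) := by
    unfold logPartition
    refine Continuous.log (by fun_prop) fun y => ne_of_gt ?_
    exact Finset.sum_pos (fun _ _ => Real.exp_pos _) Finset.univ_nonempty
  unfold outputLaw
  refine Integrable.smul_measure ?_ (by simp)
  rw [integrable_finsetSum_measure]
  intro x _
  have hmap : Measurable fun z : Fin m → ℝ => A *ᵥ symbols x + σ • z := by fun_prop
  rw [integrable_map_measure hcont.aestronglyMeasurable hmap.aemeasurable]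
  have hb : Integrable (fun z : Fin m → ℝ =>
      Real.log (Fintype.card (Fin n → ℤˣ)) + (1 / 2) * ∑ i, z i ^ 2)
      (Measure.pi fun _ : Fin m => gaussianReal 0 1) := by
    refine (integrable_const _).add (Integrable.const_mul (integrable_finsetSum _ ?_) _)
    intro i _
    have h1 : Integrable (fun t : ℝ => t ^ 2) (gaussianReal 0 1) :=
      (memLp_id_gaussianReal 2).integrable_sq
    exact integrable_comp_eval (μ := fun _ : Fin m => gaussianReal 0 1) (i := i) h1
  refine hb.mono' (hcont.comp (by fun_prop)).aestronglyMeasurable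
    (Filter.Eventually.of_forall fun z => ?_)
  have hc : (0 : ℝ) ≤ 1 / (2 * σ ^ 2) := by positivity
  have hlow : Real.exp (-((1 / 2) * ∑ i, z i ^ 2)) ≤ ∑ x' : Fin n → ℤˣ,
      Real.exp (-(1 / (2 * σ ^ 2)) *
        ∑ i, ((A *ᵥ symbols x + σ • z) i - (A *ᵥ symbols x') i) ^ 2) := by
    refine le_trans (le_of_eq ?_) (Finset.single_le_sum
      (f := fun x' => Real.exp (-(1 / (2 * σ ^ 2)) *
        ∑ i, ((A *ᵥ symbols x + σ • z) i - (A *ᵥ symbols x') i) ^ 2))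
      (fun _ _ => (Real.exp_pos _).le) (Finset.mem_univ x))
    simp only [Pi.add_apply, Pi.smul_apply, smul_eq_mul, add_sub_cancel_left, mul_pow,
      ← Finset.mul_sum]
    congr 1
    field_simp
  have hup : ∑ x' : Fin n → ℤˣ, Real.exp (-(1 / (2 * σ ^ 2)) *
        ∑ i, ((A *ᵥ symbols x + σ • z) i - (A *ᵥ symbols x') i) ^ 2) ≤
      Fintype.card (Fin n → ℤˣ) := by
    refine (Finset.sum_le_card_nsmul _ _ 1 fun x' _ => ?_).trans (by simp)
    rw [Real.exp_le_one_iff, neg_mul]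
    exact neg_nonpos.mpr (mul_nonneg hc (Finset.sum_nonneg fun _ _ => sq_nonneg _))
  have hq : 0 ≤ (1 / 2 : ℝ) * ∑ i, z i ^ 2 :=
    mul_nonneg (by norm_num) (Finset.sum_nonneg fun _ _ => sq_nonneg _)
  have hl : 0 ≤ Real.log (Fintype.card (Fin n → ℤˣ)) := Real.log_natCast_nonneg _
  have h1 := Real.log_le_log (Real.exp_pos _) hlow
  have h2 := Real.log_le_log ((Real.exp_pos _).trans_le hlow) hup
  rw [Real.log_exp] at h1
  simp only [Function.comp, logPartition, Real.norm_eq_abs]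
  rw [abs_le]
  constructor <;> linarith

end CDMA

end

/-!
The idea is Lindeberg's replacement of the entries of the matrix one at a time, with a third
derivative that is controlled by the Nishimori identity.

Write the capacity through the free energy `F(v) = E log ∑ x, exp (-‖y - v x‖² / (2σ²))` of the
codebook `v x = A x`, where `y = v x₀ + σ z` with `x₀` uniform and `z` standard Gaussian. Changing
one entry of `A` by `t` moves one coordinate of every codeword `v x` by `t` times a sign. For
fixed `x₀` and `z` the exponents are quadratic in `t`, so the third derivative of the log-partition
function is a combination of Gibbs averages, at most `⟨c₁ |ρ| + c₃ |ρ|³⟩`, where `ρ` is the residual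
of `y - v x` in that coordinate (`abs_third_deriv_le`). The Gibbs measure is the posterior law of
the input given `y`, hence a posterior sample has the same joint law with `y` as the true input,
and averaging over `x₀` and `z` replaces `ρ` by the noise `σ z`
(`sum_integral_gibbs_residual`). The average of the third derivative is therefore bounded by a
constant that depends on `σ` only, uniformly in the matrix and its size: no truncation and no
concentration argument is needed. Taylor's formula with integral remainder and Fubini's theorem turn
this into a second order expansion of `F` with a uniform cubic error (`exists_freeEnergy_taylor`).

The two entry laws share their first two moments, so replacing one entry `a / √m` costs
at most a constant times `m^{-3/2} E|a|³`
(`abs_integral_pi_sub_integral_pi_le`). There are `m n` entries and the capacity carries a factor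
`1 / n`, so the mean capacities differ by `O(m^{-1/2})` (`abs_integral_capacity_sub_le`),
and `m → ∞`. The sixth moments only serve to bound the third absolute moments.
-/

noncomputable section

namespace CDMA

/-! ### Gibbs averages and Taylor expansion of a log-partition function -/

section Gibbs

variable {S : Type*} [Fintype S]

/-- The average `⟨f⟩` of `f` under the Gibbs measure on `S` with weights proportional
to `exp (q x)`. -/
def gibbs (q f : S → ℝ) : ℝ := (∑ x, f x * Real.exp (q x)) / ∑ x, Real.exp (q x)

lemma sum_exp_pos [Nonempty S] (q : S → ℝ) : 0 < ∑ x, Real.exp (q x) :=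
  Finset.sum_pos (fun _ _ => Real.exp_pos _) Finset.univ_nonempty

lemma gibbs_eq_sum (q f : S → ℝ) :
    gibbs q f = ∑ x, (Real.exp (q x) / ∑ x', Real.exp (q x')) * f x := by
  rw [gibbs, Finset.sum_div]
  exact Finset.sum_congr rfl fun x _ => by ring

lemma gibbs_const [Nonempty S] (q : S → ℝ) (c : ℝ) : gibbs q (fun _ => c) = c := by
  rw [gibbs, ← Finset.mul_sum, mul_div_assoc, div_self (sum_exp_pos q).ne', mul_one]

lemma gibbs_add (q f g : S → ℝ) : gibbs q (fun x => f x + g x) = gibbs q f + gibbs q g := by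
  simp only [gibbs, add_mul, Finset.sum_add_distrib, add_div]

lemma gibbs_const_mul (q f : S → ℝ) (c : ℝ) : gibbs q (fun x => c * f x) = c * gibbs q f := by
  simp only [gibbs, mul_assoc, ← Finset.mul_sum, mul_div_assoc]

lemma gibbs_mono (q : S → ℝ) {f g : S → ℝ} (h : ∀ x, f x ≤ g x) : gibbs q f ≤ gibbs q g := by
  unfold gibbs
  gcongr with x
  exact h x

lemma gibbs_nonneg (q : S → ℝ) {f : S → ℝ} (h : ∀ x, 0 ≤ f x) : 0 ≤ gibbs q f :=
  div_nonneg (Finset.sum_nonneg fun x _ => mul_nonneg (h x) (Real.exp_pos _).le)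
    (Finset.sum_nonneg fun _ _ => (Real.exp_pos _).le)

lemma abs_gibbs_le (q f : S → ℝ) : |gibbs q f| ≤ gibbs q fun x => |f x| := by
  have hneg : -gibbs q (fun x => |f x|) = gibbs q fun x => (-1) * |f x| := by
    rw [gibbs_const_mul]; ring
  rw [abs_le, hneg]
  exact ⟨gibbs_mono q fun x => by linarith [neg_abs_le (f x)],
    gibbs_mono q fun x => le_abs_self _⟩

lemma gibbs_pow_three_le [Nonempty S] (q : S → ℝ) {f : S → ℝ} (h : ∀ x, 0 ≤ f x) :
    gibbs q f ^ 3 ≤ gibbs q fun x => f x ^ 3 := by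
  rw [gibbs_eq_sum, gibbs_eq_sum]
  refine Real.pow_arith_mean_le_arith_mean_pow _ _ _
    (fun x _ => div_nonneg (Real.exp_pos _).le (sum_exp_pos q).le) ?_ (fun x _ => h x) 3
  rw [← Finset.sum_div, div_self (sum_exp_pos q).ne']

lemma gibbs_sq_le [Nonempty S] (q f : S → ℝ) : gibbs q f ^ 2 ≤ gibbs q fun x => f x ^ 2 := by
  rw [gibbs_eq_sum, gibbs_eq_sum]
  refine Real.pow_arith_mean_le_arith_mean_pow_of_even _ _ _
    (fun x _ => div_nonneg (Real.exp_pos _).le (sum_exp_pos q).le) ?_ even_two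
  rw [← Finset.sum_div, div_self (sum_exp_pos q).ne']

lemma gibbs_sq_mul_gibbs_le [Nonempty S] (q : S → ℝ) {f : S → ℝ} (h : ∀ x, 0 ≤ f x) :
    gibbs q (fun x => f x ^ 2) * gibbs q f ≤ gibbs q fun x => f x ^ 3 := by
  have hM := gibbs_nonneg q h
  have h3 := gibbs_pow_three_le q h
  set M := gibbs q f
  -- Young's inequality `a² M ≤ (2 a³ + M³) / 3`, averaged over `a = f x`
  have hY : gibbs q (fun x => M * f x ^ 2) ≤ gibbs q fun x => (2 / 3) * f x ^ 3 + M ^ 3 / 3 :=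
    gibbs_mono q fun x => by
      nlinarith [mul_nonneg (add_nonneg (mul_nonneg zero_le_two (h x)) hM) (sq_nonneg (f x - M))]
  rw [gibbs_const_mul, gibbs_add, gibbs_const, gibbs_const_mul] at hY
  linarith

lemma hasDerivAt_log_sum_exp [Nonempty S] {q : S → ℝ → ℝ} {q' : S → ℝ} {t : ℝ}
    (hq : ∀ x, HasDerivAt (q x) (q' x) t) :
    HasDerivAt (fun s => Real.log (∑ x, Real.exp (q x s))) (gibbs (fun x => q x t) q') t := by
  have h := (HasDerivAt.fun_sum (u := Finset.univ) fun x _ => (hq x).exp).log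
    (sum_exp_pos fun x => q x t).ne'
  refine h.congr_deriv ?_
  simp only [gibbs, mul_comm]

/-- The derivative of a Gibbs average: the average of `f'` plus the covariance of `f` and `q'`. -/
lemma hasDerivAt_gibbs [Nonempty S] {q f : S → ℝ → ℝ} {q' f' : S → ℝ} {t : ℝ}
    (hq : ∀ x, HasDerivAt (q x) (q' x) t) (hf : ∀ x, HasDerivAt (f x) (f' x) t) :
    HasDerivAt (fun s => gibbs (fun x => q x s) (fun x => f x s))
      (gibbs (fun x => q x t) f' + gibbs (fun x => q x t) (fun x => f x t * q' x)
        - gibbs (fun x => q x t) (fun x => f x t) * gibbs (fun x => q x t) q') t := by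
  have hZ := HasDerivAt.fun_sum (u := Finset.univ) fun x _ => (hq x).exp
  have hN := HasDerivAt.fun_sum (u := Finset.univ) fun x _ => (hf x).mul (hq x).exp
  have hpos := (sum_exp_pos fun x => q x t).ne'
  refine (hN.div hZ hpos).congr_deriv ?_
  have e1 : ∑ x, (f' x * Real.exp (q x t) + f x t * (Real.exp (q x t) * q' x)) =
      ∑ x, f' x * Real.exp (q x t) + ∑ x, f x t * q' x * Real.exp (q x t) := by
    rw [← Finset.sum_add_distrib]
    exact Finset.sum_congr rfl fun x _ => by ring
  have e2 : ∑ x, Real.exp (q x t) * q' x = ∑ x, q' x * Real.exp (q x t) :=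
    Finset.sum_congr rfl fun x _ => mul_comm _ _
  simp only [gibbs, Pi.mul_apply]
  rw [e1, e2]
  field_simp

lemma continuous_gibbs {T : Type*} [TopologicalSpace T] [Nonempty S] {q f : S → T → ℝ}
    (hq : ∀ x, Continuous (q x)) (hf : ∀ x, Continuous (f x)) :
    Continuous fun t => gibbs (fun x => q x t) (fun x => f x t) := by
  unfold gibbs
  refine Continuous.div ?_ ?_ fun t => (sum_exp_pos _).ne'
  · exact continuous_finsetSum _ fun x _ => (hf x).mul (Real.continuous_exp.comp (hq x))
  · exact continuous_finsetSum _ fun x _ => Real.continuous_exp.comp (hq x)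

/-- Bound for the third derivative of `t ↦ log ∑ x, exp (q x t)`, for exponents with first
derivatives `q₁`, constant second derivatives `q₂` bounded by `D`, and vanishing third ones. -/
lemma abs_third_deriv_le [Nonempty S] (q q₁ q₂ : S → ℝ) {D : ℝ} (hD : ∀ x, |q₂ x| ≤ D) :
    |gibbs q (fun x => q₂ x * q₁ x) - gibbs q q₂ * gibbs q q₁
      + (gibbs q (fun x => 2 * (q₁ x * q₂ x)) + gibbs q (fun x => q₁ x ^ 2 * q₁ x)
          - gibbs q (fun x => q₁ x ^ 2) * gibbs q q₁)
      - 2 * gibbs q q₁ * (gibbs q q₂ + gibbs q (fun x => q₁ x ^ 2) - gibbs q q₁ ^ 2)|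
      ≤ gibbs q fun x => 6 * D * |q₁ x| + 6 * |q₁ x| ^ 3 := by
  obtain ⟨x₀⟩ := ‹Nonempty S›
  have : Nonempty S := ⟨x₀⟩
  have hD0 : 0 ≤ D := (abs_nonneg _).trans (hD x₀)
  have hM0 : 0 ≤ gibbs q (fun x => |q₁ x|) := gibbs_nonneg q fun x => abs_nonneg _
  have h1 : |gibbs q q₁| ≤ gibbs q fun x => |q₁ x| := abs_gibbs_le q q₁
  have h2 : |gibbs q q₂| ≤ D := (abs_gibbs_le q q₂).trans <| by
    simpa [gibbs_const] using gibbs_mono q hD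
  have h21 : |gibbs q (fun x => q₂ x * q₁ x)| ≤ D * gibbs q fun x => |q₁ x| := by
    rw [← gibbs_const_mul]
    refine (abs_gibbs_le _ _).trans (gibbs_mono q fun x => ?_)
    rw [abs_mul]
    exact mul_le_mul_of_nonneg_right (hD x) (abs_nonneg _)
  have h12 : gibbs q (fun x => 2 * (q₁ x * q₂ x)) = 2 * gibbs q (fun x => q₂ x * q₁ x) := by
    rw [← gibbs_const_mul]
    simp only [mul_comm (q₁ _)]
  have h3 : |gibbs q (fun x => q₁ x ^ 2 * q₁ x)| ≤ gibbs q fun x => |q₁ x| ^ 3 := by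
    refine (abs_gibbs_le _ _).trans (gibbs_mono q fun x => ?_)
    rw [← pow_succ, abs_pow]
  have hsq0 : 0 ≤ gibbs q (fun x => q₁ x ^ 2) := gibbs_nonneg q fun x => sq_nonneg _
  have hsq := gibbs_sq_mul_gibbs_le q (f := fun x => |q₁ x|) fun x => abs_nonneg _
  have hcube := gibbs_pow_three_le q (f := fun x => |q₁ x|) fun x => abs_nonneg _
  simp only [sq_abs] at hsq
  rw [h12, gibbs_add, gibbs_const_mul, gibbs_const_mul]
  have b1 : |gibbs q q₂ * gibbs q q₁| ≤ D * gibbs q fun x => |q₁ x| := by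
    rw [abs_mul]; exact mul_le_mul h2 h1 (abs_nonneg _) hD0
  have b2 : |gibbs q (fun x => q₁ x ^ 2) * gibbs q q₁| ≤ gibbs q fun x => |q₁ x| ^ 3 := by
    rw [abs_mul, abs_of_nonneg hsq0]
    exact (mul_le_mul_of_nonneg_left h1 hsq0).trans hsq
  have b3 : |gibbs q q₁ ^ 3| ≤ gibbs q fun x => |q₁ x| ^ 3 := by
    rw [abs_pow]
    exact (pow_le_pow_left₀ (abs_nonneg _) h1 3).trans hcube
  rw [abs_le] at *
  constructor <;> nlinarith

/-- Second order Taylor expansion of `t ↦ log ∑ x, exp (q x t)` at `0`, with the remainder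
bounded by an average along the segment from `0` to `t`. -/
lemma abs_log_sum_exp_taylor_le [Nonempty S] {q q₁ : S → ℝ → ℝ} {q₂ : S → ℝ} {D : ℝ}
    (hq : ∀ x t, HasDerivAt (q x) (q₁ x t) t) (hq₁ : ∀ x t, HasDerivAt (q₁ x) (q₂ x) t)
    (hD : ∀ x, |q₂ x| ≤ D) (t : ℝ) :
    |Real.log (∑ x, Real.exp (q x t)) - Real.log (∑ x, Real.exp (q x 0))
      - t * gibbs (fun x => q x 0) (fun x => q₁ x 0)
      - t ^ 2 / 2 * (gibbs (fun x => q x 0) q₂ + gibbs (fun x => q x 0) (fun x => q₁ x 0 ^ 2)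
          - gibbs (fun x => q x 0) (fun x => q₁ x 0) ^ 2)|
      ≤ |t| ^ 3 / 2 * ∫ θ in (0 : ℝ)..1, gibbs (fun x => q x (θ * t))
          (fun x => 6 * D * |q₁ x (θ * t)| + 6 * |q₁ x (θ * t)| ^ 3) := by
  have cq : ∀ x, Continuous (q x) := fun x =>
    continuous_iff_continuousAt.2 fun s => (hq x s).continuousAt
  have cq₁ : ∀ x, Continuous (q₁ x) := fun x =>
    continuous_iff_continuousAt.2 fun s => (hq₁ x s).continuousAt
  set g : ℝ → ℝ := fun s => Real.log (∑ x, Real.exp (q x s)) with hg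
  set g₁ : ℝ → ℝ := fun s => gibbs (fun x => q x s) (fun x => q₁ x s) with hg₁
  set g₂ : ℝ → ℝ := fun s => gibbs (fun x => q x s) q₂
    + gibbs (fun x => q x s) (fun x => q₁ x s ^ 2) - g₁ s ^ 2 with hg₂
  set g₃ : ℝ → ℝ := fun s => gibbs (fun x => q x s) (fun x => q₂ x * q₁ x s)
      - gibbs (fun x => q x s) q₂ * gibbs (fun x => q x s) (fun x => q₁ x s)
      + (gibbs (fun x => q x s) (fun x => 2 * (q₁ x s * q₂ x))
          + gibbs (fun x => q x s) (fun x => q₁ x s ^ 2 * q₁ x s)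
          - gibbs (fun x => q x s) (fun x => q₁ x s ^ 2)
            * gibbs (fun x => q x s) (fun x => q₁ x s))
      - 2 * gibbs (fun x => q x s) (fun x => q₁ x s) *
        (gibbs (fun x => q x s) q₂ + gibbs (fun x => q x s) (fun x => q₁ x s ^ 2)
          - gibbs (fun x => q x s) (fun x => q₁ x s) ^ 2) with hg₃
  have d0 : ∀ s, HasDerivAt g (g₁ s) s := fun s => hasDerivAt_log_sum_exp fun x => hq x s
  have d1 : ∀ s, HasDerivAt g₁ (g₂ s) s := fun s => by
    refine (hasDerivAt_gibbs (fun x => hq x s) fun x => hq₁ x s).congr_deriv ?_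
    simp only [hg₂, hg₁, sq]
  have d2 : ∀ s, HasDerivAt g₂ (g₃ s) s := fun s => by
    have a := hasDerivAt_gibbs (f := fun x _ => q₂ x) (f' := fun _ => 0)
      (fun x => hq x s) fun x => hasDerivAt_const s (q₂ x)
    have b := hasDerivAt_gibbs (f := fun x s => q₁ x s ^ 2) (f' := fun x => 2 * (q₁ x s * q₂ x))
      (fun x => hq x s) fun x => ((hq₁ x s).pow 2).congr_deriv (by push_cast; ring)
    refine ((a.add b).sub ((d1 s).pow 2)).congr_deriv ?_
    simp only [hg₃, hg₂, hg₁, gibbs_const]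
    push_cast
    ring
  have c3 : Continuous g₃ := by
    have k (f : S → ℝ → ℝ) (hf : ∀ x, Continuous (f x)) := continuous_gibbs cq hf
    have k1 := k _ cq₁
    have k2 := k (fun x _ => q₂ x) fun x => continuous_const
    have k3 := k (fun x s => q₁ x s ^ 2) fun x => (cq₁ x).pow 2
    have k4 := k (fun x s => q₁ x s ^ 2 * q₁ x s) fun x => ((cq₁ x).pow 2).mul (cq₁ x)
    have k5 := k (fun x s => q₂ x * q₁ x s) fun x => (cq₁ x).const_mul _
    have k6 := k (fun x s => 2 * (q₁ x s * q₂ x)) fun x => ((cq₁ x).mul_const _).const_mul _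
    exact ((k5.sub (k2.mul k1)).add ((k6.add k4).sub (k3.mul k1))).sub
      ((k1.const_mul 2).mul ((k2.add k3).sub (k1.pow 2)))
  -- the Taylor polynomial with moving base point `θ t`, constant up to the remainder
  set G : ℝ → ℝ := fun θ => g (θ * t) + g₁ (θ * t) * (t * (1 - θ))
    + g₂ (θ * t) * (t ^ 2 * (1 - θ) ^ 2 / 2) with hG
  have dG : ∀ θ, HasDerivAt G (g₃ (θ * t) * (t ^ 3 * (1 - θ) ^ 2 / 2)) θ := fun θ => by
    have l : HasDerivAt (fun θ : ℝ => θ * t) t θ := by simpa using (hasDerivAt_id θ).mul_const t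
    have m : HasDerivAt (fun θ : ℝ => 1 - θ) (-1) θ := by
      simpa using (hasDerivAt_id θ).const_sub 1
    have e0 := (d0 (θ * t)).comp θ l
    have e1 := ((d1 (θ * t)).comp θ l).mul (m.const_mul t)
    have e2 := ((d2 (θ * t)).comp θ l).mul (((m.pow 2).const_mul (t ^ 2)).div_const 2)
    refine ((e0.add e1).add e2).congr_deriv ?_
    simp only [Function.comp, Pi.pow_apply]
    push_cast
    ring
  have cG : Continuous fun θ => g₃ (θ * t) * (t ^ 3 * (1 - θ) ^ 2 / 2) := by fun_prop
  have key := intervalIntegral.integral_eq_sub_of_hasDerivAt (fun θ _ => dG θ)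
    (cG.intervalIntegrable 0 1)
  have e : G 1 - G 0 = g t - g 0 - t * g₁ 0 - t ^ 2 / 2 * g₂ 0 := by
    simp only [hG, one_mul, zero_mul]
    ring
  have goal_eq : g t - g 0 - t * g₁ 0 - t ^ 2 / 2 * g₂ 0 =
      ∫ θ in (0 : ℝ)..1, g₃ (θ * t) * (t ^ 3 * (1 - θ) ^ 2 / 2) := by rw [key, e]
  have cB : Continuous fun θ => gibbs (fun x => q x (θ * t))
      (fun x => 6 * D * |q₁ x (θ * t)| + 6 * |q₁ x (θ * t)| ^ 3) := by
    refine continuous_gibbs (fun x => (cq x).comp (continuous_mul_const t)) fun x => ?_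
    have := cq₁ x
    fun_prop
  change |g t - g 0 - t * g₁ 0 - t ^ 2 / 2 * g₂ 0| ≤ _
  rw [goal_eq, ← intervalIntegral.integral_const_mul]
  refine (intervalIntegral.abs_integral_le_integral_abs zero_le_one).trans
    (intervalIntegral.integral_mono_on zero_le_one (cG.abs.intervalIntegrable 0 1)
      ((cB.const_mul _).intervalIntegrable 0 1) fun θ hθ => ?_)
  have hθ' : |t ^ 3 * (1 - θ) ^ 2 / 2| ≤ |t| ^ 3 / 2 := by
    rw [abs_div, abs_mul, abs_pow, abs_of_nonneg (sq_nonneg (1 - θ)), abs_two]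
    have : (1 - θ) ^ 2 ≤ 1 := by nlinarith [hθ.1, hθ.2]
    have h0 : 0 ≤ |t| ^ 3 := by positivity
    nlinarith
  rw [abs_mul, mul_comm]
  exact mul_le_mul hθ' (abs_third_deriv_le _ _ _ hD) (abs_nonneg _) (by positivity)

end Gibbs

/-! ### Gaussian channels and the Nishimori identity -/

section Channel

variable {ι S : Type*} [Fintype ι] [Fintype S]

/-- A Gaussian vector with independent coordinates of equal variance has the product density. -/
lemma pi_gaussianReal_eq_withDensity (a : ι → ℝ) {v : NNReal} (hv : v ≠ 0) :
    (Measure.pi fun k => gaussianReal (a k) v) =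
      volume.withDensity fun y => ENNReal.ofReal (∏ k, gaussianPDFReal (a k) v (y k)) := by
  refine Measure.pi_eq fun s hs => ?_
  have hint : Integrable (fun y : ι → ℝ => ∏ k, gaussianPDFReal (a k) v (y k))
      (Measure.pi fun k => (volume : Measure ℝ).restrict (s k)) :=
    Integrable.fintype_prod_dep fun k => (integrable_gaussianPDFReal (a k) v).restrict
  rw [withDensity_apply _ (MeasurableSet.univ_pi hs), volume_pi, Measure.restrict_pi_pi,
    ← ofReal_integral_eq_lintegral_ofReal hint (Eventually.of_forall fun y =>
      Finset.prod_nonneg fun k _ => gaussianPDFReal_nonneg _ _ _),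
    integral_fintype_prod_eq_prod (fun k => gaussianPDFReal (a k) v),
    ENNReal.ofReal_prod_of_nonneg fun k _ => integral_nonneg fun y =>
      gaussianPDFReal_nonneg _ _ _]
  exact Finset.prod_congr rfl fun k _ => (gaussianReal_apply_eq_integral _ hv _).symm

/-- The logarithm, up to an additive constant, of the likelihood of the output `y` of a Gaussian
channel with noise power `σ²` and noiseless output `a`. -/
def logWeight (σ : ℝ) (a y : ι → ℝ) : ℝ := -(1 / (2 * σ ^ 2)) * ∑ k, (y k - a k) ^ 2

lemma continuous_logWeight {T : Type*} [TopologicalSpace T] (σ : ℝ) {a y : T → ι → ℝ}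
    (ha : Continuous a) (hy : Continuous y) : Continuous fun t => logWeight σ (a t) (y t) := by
  unfold logWeight
  fun_prop

/-- The output `a + σ z` of the channel has a Gaussian density around `a`. -/
lemma integral_noisy_eq {σ : ℝ} (hσ : 0 < σ) (a : ι → ℝ) {h : (ι → ℝ) → ℝ} (hh : Measurable h) :
    ∫ z, h (a + σ • z) ∂(Measure.pi fun _ : ι => gaussianReal 0 1) =
      ∫ y, h y * ((√(2 * Real.pi * σ ^ 2))⁻¹ ^ Fintype.card ι * Real.exp (logWeight σ a y)) := by
  set v : NNReal := NNReal.mk (σ ^ 2) (sq_nonneg σ) with hv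
  have hv0 : v ≠ 0 := fun h => (pow_pos hσ 2).ne' (congrArg NNReal.toReal h)
  have hmap : (Measure.pi fun _ : ι => gaussianReal 0 1).map (fun z => a + σ • z) =
      Measure.pi fun k => gaussianReal (a k) v := by
    have h1 : ∀ k, (gaussianReal 0 1).map (fun z => a k + σ * z) = gaussianReal (a k) v := by
      intro k
      have : (fun z : ℝ => a k + σ * z) = (fun z => a k + z) ∘ fun z => σ * z := rfl
      rw [this, ← Measure.map_map (by fun_prop) (by fun_prop), gaussianReal_map_const_mul,
        gaussianReal_map_const_add]
      simp [hv]
    have h2 := Measure.pi_map_pi (μ := fun _ : ι => gaussianReal 0 1)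
      (f := fun k z => a k + σ * z) (hμ := fun k => by rw [h1]; infer_instance)
      fun k => by fun_prop
    simp only [h1] at h2
    exact h2
  rw [← integral_map (φ := fun z => a + σ • z) (by fun_prop) hh.aestronglyMeasurable, hmap,
    pi_gaussianReal_eq_withDensity a hv0,
    integral_withDensity_eq_integral_toReal_smul (by fun_prop)
      (Eventually.of_forall fun _ => ENNReal.ofReal_lt_top)]
  refine integral_congr_ae (Eventually.of_forall fun y => ?_)
  simp only [smul_eq_mul]
  rw [ENNReal.toReal_ofReal (Finset.prod_nonneg fun k _ => gaussianPDFReal_nonneg _ _ _), mul_comm]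
  congr 1
  simp only [gaussianPDFReal_def, Finset.prod_mul_distrib, Finset.prod_const, ← Real.exp_sum,
    Finset.card_univ, logWeight, Finset.mul_sum]
  congr 2
  exact Finset.sum_congr rfl fun k _ => by simp only [hv, NNReal.coe_mk]; ring

/-- Bayes symmetry of the Gaussian channel: weighting outputs of the input `a` by the likelihood
of `b` is the same as weighting outputs of `b` by the likelihood of `a`. -/
lemma integral_noisy_mul_exp_comm {σ : ℝ} (hσ : 0 < σ) (a b : ι → ℝ) {h : (ι → ℝ) → ℝ}
    (hh : Measurable h) :
    ∫ z, h (a + σ • z) * Real.exp (logWeight σ b (a + σ • z))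
        ∂(Measure.pi fun _ : ι => gaussianReal 0 1) =
      ∫ z, h (b + σ • z) * Real.exp (logWeight σ a (b + σ • z))
        ∂(Measure.pi fun _ : ι => gaussianReal 0 1) := by
  have m : ∀ c, Measurable fun y : ι → ℝ => h y * Real.exp (logWeight σ c y) := fun c =>
    hh.mul (Real.measurable_exp.comp
      (continuous_logWeight σ continuous_const continuous_id).measurable)
  rw [integral_noisy_eq hσ a (m b), integral_noisy_eq hσ b (m a)]
  exact integral_congr_ae (Eventually.of_forall fun y => by ring)

lemma exp_div_sum_exp_le_one [Nonempty S] (q : S → ℝ) (x : S) :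
    Real.exp (q x) / ∑ x', Real.exp (q x') ≤ 1 :=
  (div_le_one (sum_exp_pos q)).2
    (Finset.single_le_sum (fun x' _ => (Real.exp_pos (q x')).le) (Finset.mem_univ x))

lemma integrable_gibbs_term {T : Type*} [MeasurableSpace T] {μ : Measure T} [Nonempty S]
    {q : S → T → ℝ} {f : T → ℝ} (hq : ∀ x, Measurable (q x)) (hf : Integrable f μ) (x : S) :
    Integrable (fun t => (Real.exp (q x t) / ∑ x', Real.exp (q x' t)) * f t) μ := by
  refine hf.abs.mono' (AEStronglyMeasurable.mul (Measurable.aestronglyMeasurable ?_) hf.1)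
    (Eventually.of_forall fun t => ?_)
  · exact (Real.measurable_exp.comp (hq x)).div
      (Finset.measurable_sum _ fun x' _ => Real.measurable_exp.comp (hq x'))
  · have h0 : 0 ≤ Real.exp (q x t) / ∑ x', Real.exp (q x' t) :=
      div_nonneg (Real.exp_pos _).le (sum_exp_pos fun x' => q x' t).le
    rw [Real.norm_eq_abs, abs_mul, abs_of_nonneg h0]
    exact mul_le_of_le_one_left (abs_nonneg _) (exp_div_sum_exp_le_one (fun x' => q x' t) x)

lemma integrable_gibbs {T : Type*} [MeasurableSpace T] {μ : Measure T} [Nonempty S]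
    {q f : S → T → ℝ} (hq : ∀ x, Measurable (q x)) (hf : ∀ x, Integrable (f x) μ) :
    Integrable (fun t => gibbs (fun x => q x t) fun x => f x t) μ := by
  simp only [gibbs_eq_sum]
  exact integrable_finsetSum _ fun x _ => integrable_gibbs_term hq (hf x) x

/-- The Nishimori identity: for an input uniform over the codebook `v`, the residual `y - v x` of
an input `x` drawn from the posterior given the output `y` has the law of the noise. -/
lemma sum_integral_gibbs_residual [Nonempty S] {σ : ℝ} (hσ : 0 < σ) (v : S → ι → ℝ)
    {f : (ι → ℝ) → ℝ} (hf : Measurable f)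
    (hfi : ∀ a : ι → ℝ, Integrable (fun z => f (a + σ • z))
      (Measure.pi fun _ : ι => gaussianReal 0 1)) :
    ∑ x₀, ∫ z, gibbs (fun x => logWeight σ (v x) (v x₀ + σ • z))
        (fun x => f (v x₀ + σ • z - v x)) ∂(Measure.pi fun _ : ι => gaussianReal 0 1) =
      Fintype.card S * ∫ z, f (σ • z) ∂(Measure.pi fun _ : ι => gaussianReal 0 1) := by
  set γ := Measure.pi fun _ : ι => gaussianReal 0 1 with hγ
  have hw : ∀ x x₀ : S, Measurable fun z => logWeight σ (v x) (v x₀ + σ • z) := fun x x₀ =>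
    (continuous_logWeight σ continuous_const (by fun_prop)).measurable
  have hZ : Measurable fun y => ∑ x, Real.exp (logWeight σ (v x) y) :=
    Finset.measurable_sum _ fun x _ => Real.measurable_exp.comp
      (continuous_logWeight σ continuous_const continuous_id).measurable
  have hres : ∀ x x₀ : S, Integrable (fun z => f (v x₀ + σ • z - v x)) γ := fun x x₀ => by
    simpa only [add_sub_right_comm] using hfi (v x₀ - v x)
  have swap : ∀ x x₀ : S,
      ∫ z, (Real.exp (logWeight σ (v x) (v x₀ + σ • z)) /
          ∑ x', Real.exp (logWeight σ (v x') (v x₀ + σ • z))) * f (v x₀ + σ • z - v x) ∂γ =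
        ∫ z, (Real.exp (logWeight σ (v x₀) (v x + σ • z)) /
          ∑ x', Real.exp (logWeight σ (v x') (v x + σ • z))) * f (σ • z) ∂γ := fun x x₀ => by
    have key := integral_noisy_mul_exp_comm hσ (v x₀) (v x)
      (h := fun y => f (y - v x) / ∑ x', Real.exp (logWeight σ (v x') y))
      ((hf.comp (measurable_id.sub_const _)).div hZ)
    refine Eq.trans ?_ (key.trans ?_)
    · exact integral_congr_ae (Eventually.of_forall fun z => by ring)
    · exact integral_congr_ae (Eventually.of_forall fun z => by
        simp only [add_sub_cancel_left]; ring)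
  simp only [gibbs_eq_sum]
  calc _ = ∑ x₀, ∑ x, ∫ z, (Real.exp (logWeight σ (v x₀) (v x + σ • z)) /
          ∑ x', Real.exp (logWeight σ (v x') (v x + σ • z))) * f (σ • z) ∂γ := by
        refine Finset.sum_congr rfl fun x₀ _ => ?_
        rw [integral_finsetSum _ fun x _ => integrable_gibbs_term
          (q := fun x z => logWeight σ (v x) (v x₀ + σ • z)) (fun x => hw x x₀) (hres x x₀) x]
        exact Finset.sum_congr rfl fun x _ => swap x x₀
    _ = ∑ x : S, ∫ z, f (σ • z) ∂γ := by
        rw [Finset.sum_comm]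
        refine Finset.sum_congr rfl fun x _ => ?_
        have hf0 : Integrable (fun z => f (σ • z)) γ := by simpa using hfi 0
        rw [← integral_finsetSum _ fun x₀ _ => integrable_gibbs_term
          (q := fun x' z => logWeight σ (v x') (v x + σ • z)) (fun x' => hw x' x) hf0 x₀]
        refine integral_congr_ae (Eventually.of_forall fun z => ?_)
        simp only
        rw [← Finset.sum_mul, ← Finset.sum_div, div_self (sum_exp_pos _).ne', one_mul]
    _ = _ := by rw [Finset.sum_const, nsmul_eq_mul, Finset.card_univ]

end Channel

/-! ### The averaged log-partition function of a codebook -/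

section FreeEnergy

variable {ι S : Type*}

/-- The codebook obtained by moving each codeword `v x` by `t * s x` along coordinate `i`. -/
def shift [DecidableEq ι] (v : S → ι → ℝ) (s : S → ℝ) (i : ι) (t : ℝ) (x : S) : ι → ℝ :=
  v x + Pi.single i (t * s x)

lemma shift_zero [DecidableEq ι] (v : S → ι → ℝ) (s : S → ℝ) (i : ι) : shift v s i 0 = v := by
  ext1 x
  simp [shift]

variable [Fintype ι] [Fintype S]

/-- The mean of `log ∑ x, exp (-‖y - v x‖² / (2σ²))` over the output `y` of the Gaussian channel
with noise power `σ²`, for an input uniform over the codebook `v`. -/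
def freeEnergy (σ : ℝ) (v : S → ι → ℝ) : ℝ :=
  (Fintype.card S : ℝ)⁻¹ * ∑ x₀, ∫ z, Real.log (∑ x, Real.exp (logWeight σ (v x) (v x₀ + σ • z)))
    ∂(Measure.pi fun _ : ι => gaussianReal 0 1)

/-- The log-partition function lies between the contribution of the true input `x₀` and the
logarithm of the size of the codebook. -/
lemma abs_log_sum_exp_logWeight_le {σ : ℝ} (hσ : 0 < σ) (v : S → ι → ℝ) (x₀ : S) (z : ι → ℝ) :
    |Real.log (∑ x, Real.exp (logWeight σ (v x) (v x₀ + σ • z)))| ≤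
      Real.log (Fintype.card S) + (1 / 2) * ∑ k, z k ^ 2 := by
  have : Nonempty S := ⟨x₀⟩
  have hc : (0 : ℝ) ≤ 1 / (2 * σ ^ 2) := by positivity
  have hlow : Real.exp (-((1 / 2) * ∑ k, z k ^ 2)) ≤
      ∑ x, Real.exp (logWeight σ (v x) (v x₀ + σ • z)) := by
    refine le_trans (le_of_eq ?_) (Finset.single_le_sum
      (f := fun x => Real.exp (logWeight σ (v x) (v x₀ + σ • z)))
      (fun _ _ => (Real.exp_pos _).le) (Finset.mem_univ x₀))
    simp only [logWeight, Pi.add_apply, Pi.smul_apply, smul_eq_mul, add_sub_cancel_left, mul_pow,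
      ← Finset.mul_sum]
    congr 1
    field_simp
  have hup : ∑ x, Real.exp (logWeight σ (v x) (v x₀ + σ • z)) ≤ Fintype.card S := by
    refine (Finset.sum_le_card_nsmul _ _ 1 fun x _ => ?_).trans (by simp)
    rw [Real.exp_le_one_iff, logWeight, neg_mul]
    exact neg_nonpos.mpr (mul_nonneg hc (Finset.sum_nonneg fun _ _ => sq_nonneg _))
  have hq : 0 ≤ (1 / 2 : ℝ) * ∑ k, z k ^ 2 :=
    mul_nonneg (by norm_num) (Finset.sum_nonneg fun _ _ => sq_nonneg _)
  have hl : 0 ≤ Real.log (Fintype.card S) := Real.log_natCast_nonneg _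
  have h1 := Real.log_le_log (Real.exp_pos _) hlow
  have h2 := Real.log_le_log ((Real.exp_pos _).trans_le hlow) hup
  rw [Real.log_exp] at h1
  rw [abs_le]
  constructor <;> linarith

/-- Polynomials in the absolute value of a Gaussian coordinate are integrable. -/
lemma integrable_add_mul_abs_pow (i : ι) (a b : ℝ) (p : ℕ) :
    Integrable (fun z : ι → ℝ => (a + b * |z i|) ^ p)
      (Measure.pi fun _ : ι => gaussianReal 0 1) := by
  have h : MemLp (fun t : ℝ => a + b * |t|) p (gaussianReal 0 1) :=
    (memLp_const a).add ((memLp_id_gaussianReal p).abs.const_mul b)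
  have h1 : Integrable (fun t : ℝ => (a + b * |t|) ^ p) (gaussianReal 0 1) :=
    h.integrable_norm_pow'.mono (by fun_prop) (Eventually.of_forall fun t => by simp)
  exact integrable_comp_eval (μ := fun _ : ι => gaussianReal 0 1) (i := i) h1

lemma integrable_const_add_sum_sq (c : ℝ) :
    Integrable (fun z : ι → ℝ => c + (1 / 2) * ∑ k, z k ^ 2)
      (Measure.pi fun _ : ι => gaussianReal 0 1) := by
  refine (integrable_const _).add (Integrable.const_mul (integrable_finsetSum _ fun i _ => ?_) _)
  simpa using integrable_add_mul_abs_pow (ι := ι) i 0 1 2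

lemma continuous_log_sum_exp_logWeight {T : Type*} [TopologicalSpace T] {σ : ℝ}
    {v : S → T → ι → ℝ} {y : T → ι → ℝ} [Nonempty S] (hv : ∀ x, Continuous (v x))
    (hy : Continuous y) :
    Continuous fun t => Real.log (∑ x, Real.exp (logWeight σ (v x t) (y t))) :=
  Continuous.log (continuous_finsetSum _ fun x _ =>
    Real.continuous_exp.comp (continuous_logWeight σ (hv x) hy)) fun _ => (sum_exp_pos _).ne'

lemma integrable_log_sum_exp_logWeight {σ : ℝ} (hσ : 0 < σ) (v : S → ι → ℝ) (x₀ : S) :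
    Integrable (fun z => Real.log (∑ x, Real.exp (logWeight σ (v x) (v x₀ + σ • z))))
      (Measure.pi fun _ : ι => gaussianReal 0 1) := by
  have : Nonempty S := ⟨x₀⟩
  refine (integrable_const_add_sum_sq (Real.log (Fintype.card S))).mono' ?_
    (Eventually.of_forall fun z => abs_log_sum_exp_logWeight_le hσ v x₀ z)
  exact (continuous_log_sum_exp_logWeight (fun x => continuous_const)
    (by fun_prop)).aestronglyMeasurable

/-- The free energy is bounded uniformly in the codebook. -/
lemma abs_freeEnergy_le [Nonempty S] {σ : ℝ} (hσ : 0 < σ) (v : S → ι → ℝ) :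
    |freeEnergy σ v| ≤ ∫ z : ι → ℝ, (Real.log (Fintype.card S) + (1 / 2) * ∑ k, z k ^ 2)
      ∂(Measure.pi fun _ : ι => gaussianReal 0 1) := by
  set M := ∫ z : ι → ℝ, (Real.log (Fintype.card S) + (1 / 2) * ∑ k, z k ^ 2)
      ∂(Measure.pi fun _ : ι => gaussianReal 0 1)
  have hS : (0 : ℝ) < Fintype.card S := by exact_mod_cast Fintype.card_pos
  have h : |∑ x₀, ∫ z, Real.log (∑ x, Real.exp (logWeight σ (v x) (v x₀ + σ • z)))
      ∂(Measure.pi fun _ : ι => gaussianReal 0 1)| ≤ Fintype.card S * M := by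
    refine (Finset.abs_sum_le_sum_abs _ _).trans
      ((Finset.sum_le_card_nsmul _ _ M fun x₀ _ => ?_).trans (by simp))
    rw [← Real.norm_eq_abs]
    exact norm_integral_le_of_norm_le (integrable_const_add_sum_sq _)
      (Eventually.of_forall fun z => abs_log_sum_exp_logWeight_le hσ v x₀ z)
  rw [freeEnergy, abs_mul, abs_of_nonneg (inv_nonneg.2 hS.le), inv_mul_le_iff₀ hS]
  exact h

lemma measurable_freeEnergy [Nonempty S] {T : Type*} [TopologicalSpace T]
    [SecondCountableTopology T] [MeasurableSpace T] [OpensMeasurableSpace T]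
    {σ : ℝ} {v : T → S → ι → ℝ} (hv : ∀ x, Continuous fun t => v t x) :
    Measurable fun t => freeEnergy σ (v t) := by
  refine Measurable.const_mul (Finset.measurable_sum _ fun x₀ _ => ?_) _
  refine (StronglyMeasurable.integral_prod_right (f := fun t z =>
    Real.log (∑ x, Real.exp (logWeight σ (v t x) (v t x₀ + σ • z))))
    (Continuous.stronglyMeasurable ?_)).measurable
  have := fun x => (hv x).comp (continuous_fst (X := T) (Y := ι → ℝ))
  exact continuous_log_sum_exp_logWeight (T := T × (ι → ℝ)) (v := fun x p => v p.1 x)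
    (y := fun p => v p.1 x₀ + σ • p.2) this
    ((this x₀).add (continuous_snd.const_smul σ))

lemma sum_add_single_sq [DecidableEq ι] (r : ι → ℝ) (i : ι) (e : ℝ) :
    ∑ k, (r k + (Pi.single i e : ι → ℝ) k) ^ 2 = ∑ k, r k ^ 2 + (2 * r i * e + e ^ 2) := by
  rw [← sub_eq_iff_eq_add', ← Finset.sum_sub_distrib, Fintype.sum_eq_single i]
  · simp only [Pi.single_eq_same]; ring
  · intro k hk
    simp [Pi.single_eq_of_ne hk]

/-- Shifting codewords `a`, `b` along coordinate `i` by `t p`, `t q` changes the exponent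
quadratically in `t`. -/
lemma logWeight_add_single [DecidableEq ι] (σ : ℝ) (a b w : ι → ℝ) (i : ι) (p q t : ℝ) :
    logWeight σ (a + Pi.single i (t * p)) (b + Pi.single i (t * q) + w) =
      -(1 / (2 * σ ^ 2)) * (∑ k, (b k + w k - a k) ^ 2 +
        (2 * (b i + w i - a i) * (t * (q - p)) + (t * (q - p)) ^ 2)) := by
  rw [← sum_add_single_sq (fun k => b k + w k - a k) i (t * (q - p)), logWeight]
  congr 1
  refine Finset.sum_congr rfl fun k _ => ?_
  rcases eq_or_ne k i with rfl | hk
  · simp only [Pi.add_apply, Pi.single_eq_same]; ring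
  · simp only [Pi.add_apply, Pi.single_eq_of_ne hk, add_zero]

/-- Bound, in terms of the residual `ρ`, for the third derivative of the log-partition
function along a coordinate: with `κ = 1 / (2σ²)` and codewords moving relative to each other at
speed at most `2`, the exponents have first derivative at most `4 κ |ρ|` and second derivative at
most `D = 8 κ`, and this is `6 D (4 κ |ρ|) + 6 (4 κ |ρ|)³`. -/
def cubicBound (σ ρ : ℝ) : ℝ :=
  192 * (1 / (2 * σ ^ 2)) ^ 2 * |ρ| + 384 * (1 / (2 * σ ^ 2)) ^ 3 * |ρ| ^ 3

lemma continuous_cubicBound (σ : ℝ) : Continuous (cubicBound σ) := by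
  unfold cubicBound
  fun_prop

lemma cubicBound_nonneg (σ ρ : ℝ) : 0 ≤ cubicBound σ ρ := by
  unfold cubicBound
  positivity

lemma cubicBound_mono (σ : ℝ) {a b : ℝ} (h : |a| ≤ |b|) : cubicBound σ a ≤ cubicBound σ b := by
  unfold cubicBound
  gcongr

lemma integrable_cubicBound (σ : ℝ) (i : ι) (a b : ℝ) (ha : 0 ≤ a) (hb : 0 ≤ b) :
    Integrable (fun z : ι → ℝ => cubicBound σ (a + b * |z i|))
      (Measure.pi fun _ : ι => gaussianReal 0 1) := by
  have e : ∀ z : ι → ℝ, |(a + b * |z i|)| = a + b * |z i| := fun z => abs_of_nonneg (by positivity)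
  simp only [cubicBound, e]
  refine Integrable.add ?_ ((integrable_add_mul_abs_pow i a b 3).const_mul _)
  simpa only [pow_one] using
    (integrable_add_mul_abs_pow i a b 1).const_mul (192 * (1 / (2 * σ ^ 2)) ^ 2)

/-- Half the mean of `cubicBound` under the noise. -/
def cubicConst (σ : ℝ) : ℝ := (1 / 2) * ∫ z, cubicBound σ (σ * z) ∂(gaussianReal 0 1)

lemma cubicConst_nonneg (σ : ℝ) : 0 ≤ cubicConst σ :=
  mul_nonneg (by norm_num) (integral_nonneg fun _ => cubicBound_nonneg _ _)

variable [DecidableEq ι]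

/-- Pathwise second order expansion of the log-partition function along a shift of one
coordinate of the codewords, for a fixed input `x₀` and a fixed noise `z`. -/
lemma exists_pathwise_taylor {σ : ℝ} (v : S → ι → ℝ) {s : S → ℝ}
    (hs : ∀ x, |s x| ≤ 1) (i : ι) (x₀ : S) :
    ∃ g₁ g₂ : (ι → ℝ) → ℝ,
      Integrable g₁ (Measure.pi fun _ : ι => gaussianReal 0 1) ∧
      Integrable g₂ (Measure.pi fun _ : ι => gaussianReal 0 1) ∧
      ∀ t z,
        |Real.log (∑ x, Real.exp (logWeight σ (shift v s i t x) (shift v s i t x₀ + σ • z)))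
          - Real.log (∑ x, Real.exp (logWeight σ (v x) (v x₀ + σ • z)))
          - t * g₁ z - t ^ 2 / 2 * g₂ z| ≤
        |t| ^ 3 / 2 * ∫ θ in (0 : ℝ)..1,
          gibbs (fun x => logWeight σ (shift v s i (θ * t) x) (shift v s i (θ * t) x₀ + σ • z))
            (fun x =>
              cubicBound σ ((shift v s i (θ * t) x₀ + σ • z - shift v s i (θ * t) x) i)) := by
  have : Nonempty S := ⟨x₀⟩
  set κ : ℝ := 1 / (2 * σ ^ 2) with hκ
  have hκ0 : 0 ≤ κ := by positivity
  set d : S → ℝ := fun x => s x₀ - s x with hd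
  have hd2 : ∀ x, |d x| ≤ 2 := fun x => by
    have h1 := hs x
    have h2 := hs x₀
    rw [abs_le] at *
    constructor <;> simp only [hd] <;> linarith
  set r : S → (ι → ℝ) → ℝ := fun x z => v x₀ i + σ * z i - v x i with hr
  -- exponent along the shift, with its first two derivatives
  set q : (ι → ℝ) → S → ℝ → ℝ := fun z x t =>
    logWeight σ (shift v s i t x) (shift v s i t x₀ + σ • z) with hq
  set q₁ : (ι → ℝ) → S → ℝ → ℝ := fun z x t => -(2 * κ) * d x * (r x z + t * d x) with hq₁
  set q₂ : S → ℝ := fun x => -(2 * κ) * d x ^ 2 with hq₂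
  have dq : ∀ z x t, HasDerivAt (q z x) (q₁ z x t) t := fun z x t => by
    have e : q z x = fun t => -κ * (∑ k, (v x₀ k + (σ • z) k - v x k) ^ 2 +
        (2 * r x z * (t * d x) + (t * d x) ^ 2)) := by
      ext t
      exact logWeight_add_single σ (v x) (v x₀) (σ • z) i (s x) (s x₀) t
    rw [e]
    have l : HasDerivAt (fun t : ℝ => t * d x) (d x) t := by
      simpa using (hasDerivAt_id t).mul_const (d x)
    refine ((((l.const_mul (2 * r x z)).add (l.pow 2)).const_add _).const_mul (-κ)).congr_deriv ?_
    simp only [hq₁]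
    push_cast
    ring
  have dq₁ : ∀ z x t, HasDerivAt (q₁ z x) (q₂ x) t := fun z x t => by
    have l : HasDerivAt (fun t : ℝ => r x z + t * d x) (d x) t := by
      simpa using ((hasDerivAt_id t).mul_const (d x)).const_add (r x z)
    exact (l.const_mul (-(2 * κ) * d x)).congr_deriv (by simp only [hq₂]; ring)
  have hq₂b : ∀ x, |q₂ x| ≤ 8 * κ := fun x => by
    have : d x ^ 2 ≤ 4 := by
      rw [← sq_abs]; nlinarith [hd2 x, abs_nonneg (d x)]
    simp only [hq₂]
    rw [abs_mul, abs_neg, abs_of_nonneg (by positivity), abs_of_nonneg (sq_nonneg _)]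
    nlinarith
  have hq₁b : ∀ z x t, 6 * (8 * κ) * |q₁ z x t| + 6 * |q₁ z x t| ^ 3 ≤
      cubicBound σ ((shift v s i t x₀ + σ • z - shift v s i t x) i) := fun z x t => by
    have e : (shift v s i t x₀ + σ • z - shift v s i t x) i = r x z + t * d x := by
      simp only [shift, Pi.sub_apply, Pi.add_apply, Pi.smul_apply, Pi.single_eq_same, smul_eq_mul,
        hr, hd]
      ring
    have b : |q₁ z x t| ≤ 4 * κ * |r x z + t * d x| := by
      simp only [hq₁]
      rw [abs_mul, abs_mul, abs_neg, abs_of_nonneg (show 0 ≤ 2 * κ by positivity)]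
      have := mul_le_mul_of_nonneg_left (hd2 x) (show 0 ≤ 2 * κ by positivity)
      refine mul_le_mul_of_nonneg_right ?_ (abs_nonneg _)
      linarith
    rw [e, cubicBound]
    calc 6 * (8 * κ) * |q₁ z x t| + 6 * |q₁ z x t| ^ 3
        ≤ 6 * (8 * κ) * (4 * κ * |r x z + t * d x|) + 6 * (4 * κ * |r x z + t * d x|) ^ 3 := by
          gcongr
      _ = _ := by ring
  have ir : ∀ (x : S) (p : ℕ), Integrable (fun z => (r x z) ^ p)
      (Measure.pi fun _ : ι => gaussianReal 0 1) := fun x p => by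
    refine (integrable_add_mul_abs_pow i |v x₀ i - v x i| |σ| p).mono' ?_
      (Eventually.of_forall fun z => ?_)
    · exact Continuous.aestronglyMeasurable (by simp only [hr]; fun_prop)
    · rw [Real.norm_eq_abs, abs_pow]
      refine pow_le_pow_left₀ (abs_nonneg _) ?_ p
      have : r x z = (v x₀ i - v x i) + σ * z i := by simp only [hr]; ring
      rw [this, ← abs_mul]
      exact abs_add_le _ _
  have mq : ∀ x, Measurable fun z => q z x 0 := fun x => by
    simp only [hq, shift_zero]
    exact (continuous_logWeight σ continuous_const (by fun_prop)).measurable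
  have i1 : ∀ x, Integrable (fun z => q₁ z x 0) (Measure.pi fun _ : ι => gaussianReal 0 1) :=
    fun x => by simpa [hq₁] using (ir x 1).const_mul (-(2 * κ) * d x)
  have i2 : ∀ x, Integrable (fun z => q₁ z x 0 ^ 2)
      (Measure.pi fun _ : ι => gaussianReal 0 1) :=
    fun x => ((ir x 2).const_mul ((-(2 * κ) * d x) ^ 2)).congr
      (Eventually.of_forall fun z => by simp only [hq₁]; ring)
  have I1 := integrable_gibbs mq i1
  have I2 := integrable_gibbs mq i2
  have I3 := integrable_gibbs (f := fun x _ => q₂ x)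
    (μ := Measure.pi fun _ : ι => gaussianReal 0 1) mq fun x => integrable_const _
  have I4 : Integrable (fun z => gibbs (fun x => q z x 0) (fun x => q₁ z x 0) ^ 2)
      (Measure.pi fun _ : ι => gaussianReal 0 1) := by
    refine I2.mono' (I1.1.pow 2) (Eventually.of_forall fun z => ?_)
    rw [Real.norm_eq_abs, abs_of_nonneg (sq_nonneg _)]
    exact gibbs_sq_le _ _
  refine ⟨fun z => gibbs (fun x => q z x 0) (fun x => q₁ z x 0),
    fun z => gibbs (fun x => q z x 0) q₂ + gibbs (fun x => q z x 0) (fun x => q₁ z x 0 ^ 2)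
      - gibbs (fun x => q z x 0) (fun x => q₁ z x 0) ^ 2, I1, (I3.add I2).sub I4, fun t z => ?_⟩
  have key := abs_log_sum_exp_taylor_le (dq z) (dq₁ z) hq₂b t
  simp only [hq, shift_zero] at key ⊢
  refine key.trans (mul_le_mul_of_nonneg_left ?_ (by positivity))
  have cshift : ∀ x, Continuous fun θ : ℝ => shift v s i (θ * t) x := fun x => by
    unfold shift
    exact continuous_const.add ((continuous_single i).comp (by fun_prop))
  have cq : ∀ x, Continuous fun θ : ℝ =>
      logWeight σ (shift v s i (θ * t) x) (shift v s i (θ * t) x₀ + σ • z) := fun x =>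
    continuous_logWeight σ (cshift x) ((cshift x₀).add_const _)
  refine intervalIntegral.integral_mono_on zero_le_one
    (Continuous.intervalIntegrable (continuous_gibbs cq fun x => ?_) 0 1)
    (Continuous.intervalIntegrable (continuous_gibbs cq fun x => ?_) 0 1)
    fun θ _ => gibbs_mono _ fun x => hq₁b z x (θ * t)
  · simp only [hq₁]
    fun_prop
  · exact (continuous_cubicBound σ).comp ((continuous_apply i).comp
      (((cshift x₀).add_const _).sub (cshift x)))

/-- Along a bounded shift of one coordinate of the codewords, the free energy is a quadratic
polynomial up to a cubic error that is uniform in the codebook: the third derivative is a posterior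
average of a polynomial in the residual, which the Nishimori identity turns into a moment of the
noise. -/
lemma exists_freeEnergy_taylor [Nonempty S] {σ : ℝ} (hσ : 0 < σ) (v : S → ι → ℝ) {s : S → ℝ}
    (hs : ∀ x, |s x| ≤ 1) (i : ι) :
    ∃ c₁ c₂ : ℝ, ∀ t,
      |freeEnergy σ (shift v s i t) - freeEnergy σ v - c₁ * t - c₂ * t ^ 2| ≤
        cubicConst σ * |t| ^ 3 := by
  set γ := Measure.pi fun _ : ι => gaussianReal 0 1 with hγ
  choose g₁ g₂ hg₁ hg₂ hT using exists_pathwise_taylor (σ := σ) v hs i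
  set N : ℝ := (Fintype.card S : ℝ) with hN
  have hN0 : 0 < N := by simp only [hN]; exact_mod_cast Fintype.card_pos
  refine ⟨N⁻¹ * ∑ x₀, ∫ z, g₁ x₀ z ∂γ, N⁻¹ * ∑ x₀, (∫ z, g₂ x₀ z ∂γ) / 2, fun t => ?_⟩
  set L : S → (ι → ℝ) → ℝ := fun x₀ z =>
    Real.log (∑ x, Real.exp (logWeight σ (shift v s i t x) (shift v s i t x₀ + σ • z))) with hL
  set L0 : S → (ι → ℝ) → ℝ := fun x₀ z =>
    Real.log (∑ x, Real.exp (logWeight σ (v x) (v x₀ + σ • z))) with hL0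
  have iL : ∀ x₀, Integrable (L x₀) γ := fun x₀ => integrable_log_sum_exp_logWeight hσ _ x₀
  have iL0 : ∀ x₀, Integrable (L0 x₀) γ := fun x₀ => integrable_log_sum_exp_logWeight hσ _ x₀
  have e : freeEnergy σ (shift v s i t) - freeEnergy σ v - (N⁻¹ * ∑ x₀, ∫ z, g₁ x₀ z ∂γ) * t
      - (N⁻¹ * ∑ x₀, (∫ z, g₂ x₀ z ∂γ) / 2) * t ^ 2 =
      N⁻¹ * ∑ x₀, ∫ z, (L x₀ z - L0 x₀ z - t * g₁ x₀ z - t ^ 2 / 2 * g₂ x₀ z) ∂γ := by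
    have h : ∀ x₀, ∫ z, (L x₀ z - L0 x₀ z - t * g₁ x₀ z - t ^ 2 / 2 * g₂ x₀ z) ∂γ =
        ∫ z, L x₀ z ∂γ - ∫ z, L0 x₀ z ∂γ - (∫ z, g₁ x₀ z ∂γ) * t
          - (∫ z, g₂ x₀ z ∂γ) / 2 * t ^ 2 := fun x₀ => by
      rw [integral_sub (f := fun z => L x₀ z - L0 x₀ z - t * g₁ x₀ z)
          (((iL x₀).sub (iL0 x₀)).sub ((hg₁ x₀).const_mul t)) ((hg₂ x₀).const_mul _),
        integral_sub (f := fun z => L x₀ z - L0 x₀ z) ((iL x₀).sub (iL0 x₀))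
          ((hg₁ x₀).const_mul t),
        integral_sub (iL x₀) (iL0 x₀), integral_const_mul, integral_const_mul]
      ring
    have e1 : freeEnergy σ (shift v s i t) = N⁻¹ * ∑ x₀, ∫ z, L x₀ z ∂γ := rfl
    have e0 : freeEnergy σ v = N⁻¹ * ∑ x₀, ∫ z, L0 x₀ z ∂γ := rfl
    rw [Finset.sum_congr rfl fun x₀ _ => h x₀, e1, e0]
    simp only [Finset.sum_sub_distrib, ← Finset.sum_mul]
    ring
  rw [e]
  set B : S → ℝ → (ι → ℝ) → ℝ := fun x₀ θ z =>
    gibbs (fun x => logWeight σ (shift v s i (θ * t) x) (shift v s i (θ * t) x₀ + σ • z))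
      (fun x => cubicBound σ ((shift v s i (θ * t) x₀ + σ • z - shift v s i (θ * t) x) i)) with hB
  have cB : ∀ x₀, Continuous (Function.uncurry (B x₀)) := fun x₀ => by
    have cs : ∀ x, Continuous fun p : ℝ × (ι → ℝ) => shift v s i (p.1 * t) x := fun x => by
      unfold shift
      exact continuous_const.add ((continuous_single i).comp (by fun_prop))
    have cy : Continuous fun p : ℝ × (ι → ℝ) => shift v s i (p.1 * t) x₀ + σ • p.2 :=
      (cs x₀).add (continuous_snd.const_smul σ)
    exact continuous_gibbs
      (q := fun x (p : ℝ × (ι → ℝ)) =>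
        logWeight σ (shift v s i (p.1 * t) x) (shift v s i (p.1 * t) x₀ + σ • p.2))
      (f := fun x (p : ℝ × (ι → ℝ)) =>
        cubicBound σ ((shift v s i (p.1 * t) x₀ + σ • p.2 - shift v s i (p.1 * t) x) i))
      (fun x => continuous_logWeight σ (cs x) cy)
      fun x => (continuous_cubicBound σ).comp ((continuous_apply i).comp (cy.sub (cs x)))
  set I01 : Measure ℝ := volume.restrict (Set.Ioc 0 1) with hI01
  have hfin : IsFiniteMeasure I01 := ⟨by simp [hI01]⟩
  -- a bound for the residuals that is uniform over the segment
  set V : ℝ := ∑ x, ∑ x', |v x i - v x' i| + 2 * |t| with hV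
  have hV0 : 0 ≤ V := by positivity
  have iB : ∀ x₀, Integrable (Function.uncurry (B x₀)) (I01.prod γ) := fun x₀ => by
    have hdom : Integrable (fun p : ℝ × (ι → ℝ) => cubicBound σ (V + |σ| * |p.2 i|))
        (I01.prod γ) := (integrable_cubicBound σ i V |σ| hV0 (abs_nonneg _)).comp_snd I01
    refine hdom.mono' (cB x₀).aestronglyMeasurable ?_
    have hmem : ∀ᵐ p ∂(I01.prod γ), p.1 ∈ Set.Ioc (0 : ℝ) 1 :=
      Measure.quasiMeasurePreserving_fst.ae (ae_restrict_mem measurableSet_Ioc)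
    filter_upwards [hmem] with p hp
    have hbd : ∀ x, cubicBound σ ((shift v s i (p.1 * t) x₀ + σ • p.2 -
        shift v s i (p.1 * t) x) i) ≤ cubicBound σ (V + |σ| * |p.2 i|) := fun x => by
      refine cubicBound_mono σ ((?_ : _ ≤ V + |σ| * |p.2 i|).trans (le_abs_self _))
      have e1 : (shift v s i (p.1 * t) x₀ + σ • p.2 - shift v s i (p.1 * t) x) i =
          (v x₀ i - v x i) + p.1 * t * (s x₀ - s x) + σ * p.2 i := by
        simp only [shift, Pi.sub_apply, Pi.add_apply, Pi.smul_apply, Pi.single_eq_same,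
          smul_eq_mul]
        ring
      have e2 : |v x₀ i - v x i| ≤ ∑ x, ∑ x', |v x i - v x' i| :=
        (Finset.single_le_sum (f := fun x' => |v x₀ i - v x' i|) (fun _ _ => abs_nonneg _)
          (Finset.mem_univ x)).trans
        (Finset.single_le_sum (f := fun x => ∑ x', |v x i - v x' i|)
          (fun _ _ => Finset.sum_nonneg fun _ _ => abs_nonneg _) (Finset.mem_univ x₀))
      have e3 : |p.1 * t * (s x₀ - s x)| ≤ 2 * |t| := by
        have h1 : |s x₀ - s x| ≤ 2 := (abs_sub _ _).trans (by linarith [hs x₀, hs x])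
        rw [abs_mul, abs_mul, abs_of_nonneg hp.1.le]
        have h2 : p.1 * |t| ≤ |t| := mul_le_of_le_one_left (abs_nonneg _) hp.2
        have := mul_le_mul h2 h1 (abs_nonneg _) (abs_nonneg _)
        linarith
      rw [e1]
      refine (abs_add_le _ _).trans ?_
      rw [abs_mul σ]
      have := abs_add_le (v x₀ i - v x i) (p.1 * t * (s x₀ - s x))
      simp only [hV]
      linarith
    simp only [Function.uncurry, hB]
    rw [Real.norm_eq_abs, abs_of_nonneg (gibbs_nonneg _ fun x => cubicBound_nonneg _ _)]
    exact (gibbs_mono _ hbd).trans (gibbs_const _ _).le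
  have swap : ∀ x₀, ∫ z, (∫ θ in (0 : ℝ)..1, B x₀ θ z) ∂γ =
      ∫ θ in (0 : ℝ)..1, ∫ z, B x₀ θ z ∂γ := fun x₀ => by
    simp only [intervalIntegral.integral_of_le zero_le_one]
    exact (integral_integral_swap (iB x₀)).symm
  have nish : ∀ θ, ∑ x₀, ∫ z, B x₀ θ z ∂γ = N * (2 * cubicConst σ) := fun θ => by
    have h := sum_integral_gibbs_residual hσ (shift v s i (θ * t))
      (f := fun u => cubicBound σ (u i))
      ((continuous_cubicBound σ).comp (continuous_apply i)).measurable fun a => by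
        refine (integrable_cubicBound σ i |a i| |σ| (abs_nonneg _) (abs_nonneg _)).mono'
          ((continuous_cubicBound σ).comp (by fun_prop)).aestronglyMeasurable
          (Eventually.of_forall fun z => ?_)
        rw [Real.norm_eq_abs, abs_of_nonneg (cubicBound_nonneg _ _)]
        refine cubicBound_mono σ ((abs_add_le _ _).trans (le_trans ?_ (le_abs_self _)))
        simp [abs_mul]
    refine h.trans ?_
    have h2 := integral_comp_eval (μ := fun _ : ι => gaussianReal 0 1) (i := i)
      (f := fun z => cubicBound σ (σ * z))
      ((continuous_cubicBound σ).comp (continuous_const_mul σ)).aestronglyMeasurable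
    simp only [Pi.smul_apply, smul_eq_mul]
    rw [h2, cubicConst]
    ring
  have bound : ∀ x₀, |∫ z, (L x₀ z - L0 x₀ z - t * g₁ x₀ z - t ^ 2 / 2 * g₂ x₀ z) ∂γ| ≤
      |t| ^ 3 / 2 * ∫ θ in (0 : ℝ)..1, ∫ z, B x₀ θ z ∂γ := fun x₀ => by
    rw [← swap, ← integral_const_mul, ← Real.norm_eq_abs]
    refine norm_integral_le_of_norm_le (Integrable.const_mul ?_ _)
      (Eventually.of_forall fun z => hT x₀ t z)
    simp only [intervalIntegral.integral_of_le zero_le_one]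
    exact (iB x₀).integral_prod_right
  have hsum : ∑ x₀, ∫ θ in (0 : ℝ)..1, ∫ z, B x₀ θ z ∂γ = N * (2 * cubicConst σ) := by
    rw [← intervalIntegral.integral_finsetSum fun x₀ _ => by
      rw [intervalIntegrable_iff_integrableOn_Ioc_of_le zero_le_one]
      exact (iB x₀).integral_prod_left]
    simp only [nish, intervalIntegral.integral_const, sub_zero, one_smul]
  rw [abs_mul, abs_of_nonneg (inv_nonneg.2 hN0.le), inv_mul_le_iff₀ hN0]
  calc |∑ x₀, ∫ z, (L x₀ z - L0 x₀ z - t * g₁ x₀ z - t ^ 2 / 2 * g₂ x₀ z) ∂γ|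
      ≤ ∑ x₀, |t| ^ 3 / 2 * ∫ θ in (0 : ℝ)..1, ∫ z, B x₀ θ z ∂γ :=
        (Finset.abs_sum_le_sum_abs _ _).trans (Finset.sum_le_sum fun x₀ _ => bound x₀)
    _ = N * (cubicConst σ * |t| ^ 3) := by rw [← Finset.mul_sum, hsum]; ring

end FreeEnergy

/-! ### The replacement principle on product measures -/

section Replacement

variable {ι : Type*} [DecidableEq ι]

lemma measurable_update_pair (i : ι) :
    Measurable fun p : (ι → ℝ) × ℝ => Function.update p.1 i p.2 := by
  refine measurable_pi_lambda _ fun j => ?_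
  rcases eq_or_ne j i with rfl | h
  · simpa using measurable_snd
  · simp only [Function.update_of_ne h]
    fun_prop

variable [Fintype ι]

/-- Replacing the `i`-th factor of a product law amounts to resampling the `i`-th coordinate. -/
lemma pi_update_eq_map (ρ : ι → Measure ℝ) [∀ i, IsProbabilityMeasure (ρ i)] (i : ι)
    (μ : Measure ℝ) [IsProbabilityMeasure μ] :
    Measure.pi (Function.update ρ i μ) =
      ((Measure.pi ρ).prod μ).map fun p => Function.update p.1 i p.2 := by
  have hprob : ∀ j, IsProbabilityMeasure (Function.update ρ i μ j) := fun j => by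
    rcases eq_or_ne j i with rfl | h
    · simpa
    · simpa [h] using inferInstanceAs (IsProbabilityMeasure (ρ j))
  refine Measure.pi_eq fun s hs => ?_
  rw [Measure.map_apply (measurable_update_pair i) (MeasurableSet.univ_pi hs)]
  have hpre : (fun p : (ι → ℝ) × ℝ => Function.update p.1 i p.2) ⁻¹' Set.univ.pi s =
      (Set.univ.pi (Function.update s i Set.univ)) ×ˢ s i := by
    ext p
    simp only [Set.mem_preimage, Set.mem_pi, Set.mem_univ, true_imp_iff, Set.mem_prod]
    constructor
    · intro h
      refine ⟨fun j => ?_, by simpa using h i⟩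
      rcases eq_or_ne j i with rfl | hj
      · simp
      · simpa [hj] using h j
    · rintro ⟨h, hi⟩ j
      rcases eq_or_ne j i with rfl | hj
      · simpa using hi
      · simpa [hj] using h j
  rw [hpre, Measure.prod_prod, Measure.pi_pi, ← Finset.prod_erase_mul _ _ (Finset.mem_univ i),
    ← Finset.prod_erase_mul (a := i) _ (fun j => Function.update ρ i μ j (s j))
      (Finset.mem_univ i)]
  simp only [Function.update_self, measure_univ, mul_one]
  congr 1
  refine Finset.prod_congr rfl fun j hj => ?_
  simp [Finset.ne_of_mem_erase hj]

/-- Up to a third moment, the integral of a function that is quadratic with a cubic error does not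
depend on the standardized law against which it is taken. -/
lemma abs_integral_sub_quadratic_le {h : ℝ → ℝ} {C M c₁ c₂ K : ℝ} (hm : Measurable h)
    (hb : ∀ t, |h t| ≤ M)
    (hT : ∀ t, |h t - h 0 - c₁ * t - c₂ * t ^ 2| ≤ C * |t| ^ 3)
    (μ : Measure ℝ) [IsProbabilityMeasure μ] (h3 : Integrable (fun t => |t| ^ 3) μ)
    (hmean : ∫ t, t ∂μ = 0) (hvar : ∫ t, t ^ 2 ∂μ = 1) (hK : ∫ t, |t| ^ 3 ∂μ ≤ K) (hC : 0 ≤ C) :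
    |∫ t, h t ∂μ - (h 0 + c₂)| ≤ C * K := by
  have hh : Integrable h μ := Integrable.of_bound hm.aestronglyMeasurable M
    (Eventually.of_forall hb)
  have hdom : Integrable (fun t : ℝ => 1 + |t| ^ 3) μ := (integrable_const _).add h3
  have i1 : Integrable (fun t : ℝ => t) μ :=
    hdom.mono' (by fun_prop) (Eventually.of_forall fun t => by
      rw [Real.norm_eq_abs]
      nlinarith [sq_nonneg (|t| - 1), abs_nonneg t,
        mul_nonneg (abs_nonneg t) (sq_nonneg (|t| - 1))])
  have i2 : Integrable (fun t : ℝ => t ^ 2) μ :=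
    hdom.mono' (by fun_prop) (Eventually.of_forall fun t => by
      rw [Real.norm_eq_abs, abs_pow]
      rcases le_total (|t|) 1 with h | h
      · nlinarith [abs_nonneg t, pow_nonneg (abs_nonneg t) 3]
      · nlinarith [abs_nonneg t, mul_nonneg (sq_nonneg |t|) (sub_nonneg.2 h)])
  have e : ∫ t, (h t - h 0 - c₁ * t - c₂ * t ^ 2) ∂μ = ∫ t, h t ∂μ - (h 0 + c₂) := by
    rw [integral_sub, integral_sub, integral_sub hh (integrable_const _), integral_const_mul,
      integral_const_mul, hmean, hvar]
    · simp only [integral_const, probReal_univ, one_smul]; ring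
    · exact hh.sub (integrable_const _)
    · exact i1.const_mul _
    · exact (hh.sub (integrable_const _)).sub (i1.const_mul _)
    · exact i2.const_mul _
  rw [← e]
  calc |∫ t, (h t - h 0 - c₁ * t - c₂ * t ^ 2) ∂μ|
      ≤ ∫ t, C * |t| ^ 3 ∂μ :=
        by
        rw [← Real.norm_eq_abs]
        exact norm_integral_le_of_norm_le (h3.const_mul C) (Eventually.of_forall hT)
    _ ≤ C * K := by rw [integral_const_mul]; exact mul_le_mul_of_nonneg_left hK hC

/-- Lindeberg's replacement principle: if `f` is, in each coordinate, a quadratic polynomial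
up to a uniform cubic error, then its mean over i.i.d. coordinates depends little on
their common standardized law. -/
lemma abs_integral_pi_sub_integral_pi_le {f : (ι → ℝ) → ℝ} {C M K L : ℝ} (hf : Measurable f)
    (hb : ∀ a, |f a| ≤ M) (hC : 0 ≤ C)
    (hT : ∀ a i, ∃ c₁ c₂ : ℝ, ∀ t,
      |f (Function.update a i t) - f (Function.update a i 0) - c₁ * t - c₂ * t ^ 2| ≤ C * |t| ^ 3)
    (μ ν : Measure ℝ) [IsProbabilityMeasure μ] [IsProbabilityMeasure ν]
    (hμ3 : Integrable (fun t => |t| ^ 3) μ) (hν3 : Integrable (fun t => |t| ^ 3) ν)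
    (hμ1 : ∫ t, t ∂μ = 0) (hν1 : ∫ t, t ∂ν = 0)
    (hμ2 : ∫ t, t ^ 2 ∂μ = 1) (hν2 : ∫ t, t ^ 2 ∂ν = 1)
    (hK : ∫ t, |t| ^ 3 ∂μ ≤ K) (hL : ∫ t, |t| ^ 3 ∂ν ≤ L) :
    |∫ a, f a ∂(Measure.pi fun _ : ι => μ) - ∫ a, f a ∂(Measure.pi fun _ : ι => ν)| ≤
      Fintype.card ι * (C * (K + L)) := by
  -- hybrid laws: the coordinates in `s` are already replaced
  set ρ : Finset ι → ι → Measure ℝ := fun s i => if i ∈ s then ν else μ with hρ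
  have hprob : ∀ s i, IsProbabilityMeasure (ρ s i) := fun s i => by
    simp only [hρ]; split_ifs <;> infer_instance
  have swap : ∀ (s : Finset ι) (i : ι) (τ : Measure ℝ) [IsProbabilityMeasure τ],
      ∫ a, f a ∂(Measure.pi (Function.update (ρ s) i τ)) =
        ∫ a, ∫ t, f (Function.update a i t) ∂τ ∂(Measure.pi (ρ s)) := fun s i τ _ => by
    rw [pi_update_eq_map,
      integral_map (measurable_update_pair i).aemeasurable hf.aestronglyMeasurable]
    exact integral_prod _ (Integrable.of_bound
      (hf.comp (measurable_update_pair i)).aestronglyMeasurable M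
      (Eventually.of_forall fun p => hb _))
  have inner_int : ∀ (s : Finset ι) (i : ι) (τ : Measure ℝ) [IsProbabilityMeasure τ],
      Integrable (fun a => ∫ t, f (Function.update a i t) ∂τ) (Measure.pi (ρ s)) :=
    fun s i τ _ => Integrable.integral_prod_left (f := fun p : (ι → ℝ) × ℝ =>
      f (Function.update p.1 i p.2)) (Integrable.of_bound
        (hf.comp (measurable_update_pair i)).aestronglyMeasurable M
        (Eventually.of_forall fun p => hb _))
  have main : ∀ s : Finset ι,
      |∫ a, f a ∂(Measure.pi (ρ ∅)) - ∫ a, f a ∂(Measure.pi (ρ s))| ≤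
        s.card * (C * (K + L)) := by
    intro s
    induction s using Finset.induction_on with
    | empty => simp
    | insert i s hi ih =>
      have u1 : ρ s = Function.update (ρ s) i μ := by
        rw [eq_comm, Function.update_eq_self_iff]
        simp [hρ, hi]
      have u2 : ρ (insert i s) = Function.update (ρ s) i ν := by
        ext1 j
        rcases eq_or_ne j i with rfl | hj
        · simp [hρ]
        · simp [hρ, hj]
      have step : |∫ a, f a ∂(Measure.pi (ρ s)) - ∫ a, f a ∂(Measure.pi (ρ (insert i s)))| ≤
          C * (K + L) := by
        have e1 : ∫ a, f a ∂(Measure.pi (ρ s)) =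
            ∫ a, ∫ t, f (Function.update a i t) ∂μ ∂(Measure.pi (ρ s)) := by
          rw [← swap s i μ, ← u1]
        rw [e1, u2, swap s i ν, ← integral_sub (inner_int s i μ) (inner_int s i ν)]
        have := norm_integral_le_of_norm_le_const (μ := Measure.pi (ρ s)) (C := C * (K + L))
          (f := fun a => ∫ t, f (Function.update a i t) ∂μ - ∫ t, f (Function.update a i t) ∂ν)
          (Eventually.of_forall fun a => ?_)
        · simpa using this
        obtain ⟨c₁, c₂, h⟩ := hT a i
        have hm : Measurable fun t => f (Function.update a i t) := hf.comp (measurable_update a)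
        have b1 := abs_integral_sub_quadratic_le hm (fun t => hb _) h μ hμ3 hμ1 hμ2 hK hC
        have b2 := abs_integral_sub_quadratic_le hm (fun t => hb _) h ν hν3 hν1 hν2 hL hC
        rw [Real.norm_eq_abs]
        rw [abs_le] at *
        constructor <;> linarith
      rw [Finset.card_insert_of_notMem hi]
      push_cast
      rw [abs_le] at *
      constructor <;> linarith
  have := main Finset.univ
  simpa [hρ] using this

end Replacement

/-! ### Capacity as a function of the matrix entries -/

section Capacity

variable {m n : ℕ}

/-- The capacity is affine in the free energy of the codebook of noiseless outputs. -/
lemma capacity_eq_freeEnergy {σ : ℝ} (hσ : 0 < σ) (A : Matrix (Fin m) (Fin n) ℝ) :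
    capacity σ A = Real.log 2 - (1 / 2) * ((m : ℝ) / n)
      - (1 / n) * freeEnergy σ fun x : Fin n → ℤˣ => A *ᵥ symbols x := by
  have hc : Continuous (logPartition σ A) :=
    continuous_log_sum_exp_logWeight (S := Fin n → ℤˣ)
      (v := fun x (_ : Fin m → ℝ) => A *ᵥ symbols x) (fun x => continuous_const) continuous_id
  have hm : ∀ x : Fin n → ℤˣ, Measurable fun z : Fin m → ℝ => A *ᵥ symbols x + σ • z :=
    fun x => by fun_prop
  have hi : ∀ x ∈ (Finset.univ : Finset (Fin n → ℤˣ)), Integrable (logPartition σ A)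
      ((Measure.pi fun _ : Fin m => gaussianReal 0 1).map fun z => A *ᵥ symbols x + σ • z) :=
    fun x _ => (integrable_map_measure hc.aestronglyMeasurable (hm x).aemeasurable).2
      (integrable_log_sum_exp_logWeight hσ (fun x => A *ᵥ symbols x) x)
  rw [capacity, outputLaw, integral_smul_measure, integral_finsetSum_measure hi, freeEnergy]
  congr 3
  · simp
  · exact Finset.sum_congr rfl fun x _ =>
      integral_map (hm x).aemeasurable hc.aestronglyMeasurable

lemma abs_symbols_le (x : Fin n → ℤˣ) (j : Fin n) : |symbols x j| ≤ 1 := by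
  rcases Int.units_eq_one_or (x j) with h | h <;> simp [symbols, h]

/-- The free energy of the channel with spreading matrix `m^{-1/2} a`, as a function of the family
`a` of matrix entries. -/
def entryFreeEnergy (σ : ℝ) (a : Fin m × Fin n → ℝ) : ℝ :=
  freeEnergy σ fun x : Fin n → ℤˣ =>
    ((√(m : ℝ))⁻¹ • (Matrix.of fun i j => a (i, j) : Matrix (Fin m) (Fin n) ℝ)) *ᵥ symbols x

lemma measurable_entryFreeEnergy (σ : ℝ) :
    Measurable (entryFreeEnergy σ : (Fin m × Fin n → ℝ) → ℝ) :=
  measurable_freeEnergy fun x => by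
    have h : Continuous fun a : Fin m × Fin n → ℝ =>
        (Matrix.of fun i j => a (i, j) : Matrix (Fin m) (Fin n) ℝ) :=
      continuous_matrix fun i j => continuous_apply (i, j)
    exact (h.const_smul (√(m : ℝ))⁻¹).matrix_mulVec continuous_const

/-- Changing one entry of the matrix shifts one coordinate of the noiseless outputs. -/
lemma mulVec_update_eq_shift (c : ℝ) (a : Fin m × Fin n → ℝ) (p : Fin m × Fin n) (t : ℝ) :
    (fun x : Fin n → ℤˣ => (c • (Matrix.of fun i j => Function.update a p t (i, j) :
      Matrix (Fin m) (Fin n) ℝ)) *ᵥ symbols x) =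
    shift (fun x : Fin n → ℤˣ => (c • (Matrix.of fun i j => Function.update a p 0 (i, j) :
      Matrix (Fin m) (Fin n) ℝ)) *ᵥ symbols x) (fun x => symbols x p.2) p.1 (c * t) := by
  have e : (c • (Matrix.of fun i j => Function.update a p t (i, j) :
      Matrix (Fin m) (Fin n) ℝ)) = c • (Matrix.of fun i j => Function.update a p 0 (i, j) :
      Matrix (Fin m) (Fin n) ℝ) + Matrix.single p.1 p.2 (c * t) := by
    ext i j
    by_cases h : (i, j) = p
    · subst h
      simp
    · have h' : ¬ (p.1 = i ∧ p.2 = j) := fun h'' => h (Prod.ext h''.1.symm h''.2.symm)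
      simp [Function.update_of_ne h, Matrix.single, h']
  ext1 x
  rw [e, Matrix.add_mulVec, shift]
  congr 1
  exact Matrix.single_mulVec ..

/-- The free energy is, in each entry, quadratic up to a cubic error of order `m^{-3/2}`. -/
lemma exists_entryFreeEnergy_taylor {σ : ℝ} (hσ : 0 < σ) (a : Fin m × Fin n → ℝ)
    (p : Fin m × Fin n) :
    ∃ c₁ c₂ : ℝ, ∀ t, |entryFreeEnergy σ (Function.update a p t)
      - entryFreeEnergy σ (Function.update a p 0) - c₁ * t - c₂ * t ^ 2| ≤
        (cubicConst σ * (√(m : ℝ))⁻¹ ^ 3) * |t| ^ 3 := by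
  set c : ℝ := (√(m : ℝ))⁻¹ with hc
  have hc0 : 0 ≤ c := by positivity
  obtain ⟨c₁, c₂, h⟩ := exists_freeEnergy_taylor hσ
    (fun x : Fin n → ℤˣ => (c • (Matrix.of fun i j => Function.update a p 0 (i, j) :
      Matrix (Fin m) (Fin n) ℝ)) *ᵥ symbols x)
    (s := fun x => symbols x p.2) (fun x => abs_symbols_le x p.2) p.1
  refine ⟨c₁ * c, c₂ * c ^ 2, fun t => ?_⟩
  have := h (c * t)
  rw [← mulVec_update_eq_shift, abs_mul, abs_of_nonneg hc0] at this
  refine le_trans (le_of_eq ?_) (this.trans (le_of_eq (by ring)))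
  simp only [entryFreeEnergy, ← hc]
  congr 1
  ring

lemma capacity_eq_entryFreeEnergy {σ : ℝ} (hσ : 0 < σ) (A : Matrix (Fin m) (Fin n) ℝ) :
    capacity σ ((√(m : ℝ))⁻¹ • A) = Real.log 2 - (1 / 2) * ((m : ℝ) / n)
      - (1 / n) * entryFreeEnergy σ fun p : Fin m × Fin n => A p.1 p.2 :=
  capacity_eq_freeEnergy hσ _

variable {Ω : Type*} [MeasurableSpace Ω] {P : Measure Ω} {A : Ω → Matrix (Fin m) (Fin n) ℝ}

lemma integrable_entryFreeEnergy [IsProbabilityMeasure P] {σ : ℝ} (hσ : 0 < σ)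
    (hA : ∀ i j, Measurable fun ω => A ω i j) :
    Integrable (fun ω => entryFreeEnergy σ fun p : Fin m × Fin n => A ω p.1 p.2) P :=
  Integrable.of_bound ((measurable_entryFreeEnergy σ).comp
    (measurable_pi_lambda _ fun p => hA p.1 p.2)).aestronglyMeasurable _
    (Eventually.of_forall fun _ => abs_freeEnergy_le hσ _)

lemma integrable_capacity [IsProbabilityMeasure P] {σ : ℝ} (hσ : 0 < σ)
    (hA : ∀ i j, Measurable fun ω => A ω i j) :
    Integrable (fun ω => capacity σ ((√(m : ℝ))⁻¹ • A ω)) P := by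
  simp only [capacity_eq_entryFreeEnergy hσ]
  exact (integrable_const _).sub ((integrable_entryFreeEnergy hσ hA).const_mul _)

/-- The law of a standardized i.i.d. matrix is a power of a standardized law on `ℝ` with controlled
third absolute moment. -/
lemma exists_entry_law [IsProbabilityMeasure P] {K : ℝ} (p₀ : Fin m × Fin n)
    (hA : ∀ i j, Measurable fun ω => A ω i j)
    (hind : iIndepFun (fun (p : Fin m × Fin n) ω => A ω p.1 p.2) P)
    (hid : ∀ i j i' j', IdentDistrib (fun ω => A ω i j) (fun ω => A ω i' j') P P)
    (h1 : ∀ i j, ∫ ω, A ω i j ∂P = 0) (h2 : ∀ i j, ∫ ω, A ω i j ^ 2 ∂P = 1)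
    (h6 : ∀ i j, Integrable (fun ω => A ω i j ^ 6) P ∧ ∫ ω, A ω i j ^ 6 ∂P ≤ K) :
    ∃ μ : Measure ℝ, IsProbabilityMeasure μ ∧
      P.map (fun ω (p : Fin m × Fin n) => A ω p.1 p.2) = Measure.pi (fun _ => μ) ∧
      Integrable (fun t => |t| ^ 3) μ ∧ ∫ t, t ∂μ = 0 ∧ ∫ t, t ^ 2 ∂μ = 1 ∧
      ∫ t, |t| ^ 3 ∂μ ≤ 1 + K := by
  obtain ⟨i, j⟩ := p₀
  have hm := (hA i j).aemeasurable (μ := P)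
  obtain ⟨h6i, h6K⟩ := h6 i j
  have hle : ∀ t : ℝ, |t| ^ 3 ≤ 1 + t ^ 6 := fun t => by
    have : t ^ 6 = (|t| ^ 3) ^ 2 := by
      rw [← pow_mul, ← abs_pow]
      exact (abs_of_nonneg (by positivity)).symm
    rw [this]
    nlinarith [sq_nonneg (|t| ^ 3 - 1), pow_nonneg (abs_nonneg t) 3]
  have hdom : Integrable (fun ω => 1 + A ω i j ^ 6) P := (integrable_const _).add h6i
  have h3 : Integrable (fun ω => |A ω i j| ^ 3) P :=
    hdom.mono' (((hA i j).abs.pow_const 3)).aestronglyMeasurable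
      (Eventually.of_forall fun ω => by
        rw [Real.norm_eq_abs, abs_of_nonneg (by positivity)]
        exact hle _)
  refine ⟨P.map fun ω => A ω i j, Measure.isProbabilityMeasure_map hm, ?_, ?_, ?_, ?_, ?_⟩
  · refine ((iIndepFun_iff_map_fun_eq_pi_map
      (f := fun (p : Fin m × Fin n) ω => A ω p.1 p.2)
      fun p => (hA p.1 p.2).aemeasurable).1 hind).trans ?_
    congr 1
    ext1 p
    exact (hid p.1 p.2 i j).map_eq
  · exact (integrable_map_measure (by fun_prop) hm).2 h3
  · rw [integral_map hm (by fun_prop)]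
    exact h1 i j
  · rw [integral_map hm (by fun_prop)]
    exact h2 i j
  · rw [integral_map hm (by fun_prop)]
    calc ∫ ω, |A ω i j| ^ 3 ∂P ≤ ∫ ω, (1 + A ω i j ^ 6) ∂P :=
          integral_mono h3 hdom fun ω => hle _
      _ ≤ 1 + K := by
          rw [integral_add (integrable_const _) h6i]
          simpa using h6K

end Capacity

/-- Quantitative universality: the mean capacities of two standardized i.i.d. matrices of the
same size differ by `O(m^{-1/2})`. -/
lemma abs_integral_capacity_sub_le {m n : ℕ} {Ω Ω' : Type*} [MeasurableSpace Ω]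
    [MeasurableSpace Ω'] {P : Measure Ω} {P' : Measure Ω'} [IsProbabilityMeasure P]
    [IsProbabilityMeasure P'] {A : Ω → Matrix (Fin m) (Fin n) ℝ}
    {B : Ω' → Matrix (Fin m) (Fin n) ℝ} {σ K L : ℝ} (hσ : 0 < σ)
    (hA : ∀ i j, Measurable fun ω => A ω i j) (hB : ∀ i j, Measurable fun ω => B ω i j)
    {μ ν : Measure ℝ} [IsProbabilityMeasure μ] [IsProbabilityMeasure ν]
    (hAμ : P.map (fun ω (p : Fin m × Fin n) => A ω p.1 p.2) = Measure.pi (fun _ => μ))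
    (hBν : P'.map (fun ω (p : Fin m × Fin n) => B ω p.1 p.2) = Measure.pi (fun _ => ν))
    (hμ3 : Integrable (fun t => |t| ^ 3) μ) (hν3 : Integrable (fun t => |t| ^ 3) ν)
    (hμ1 : ∫ t, t ∂μ = 0) (hν1 : ∫ t, t ∂ν = 0)
    (hμ2 : ∫ t, t ^ 2 ∂μ = 1) (hν2 : ∫ t, t ^ 2 ∂ν = 1)
    (hK : ∫ t, |t| ^ 3 ∂μ ≤ K) (hL : ∫ t, |t| ^ 3 ∂ν ≤ L) (hn : n ≠ 0) :
    |∫ ω, capacity σ ((√(m : ℝ))⁻¹ • A ω) ∂P - ∫ ω, capacity σ ((√(m : ℝ))⁻¹ • B ω) ∂P'| ≤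
      cubicConst σ * (K + L) * (√(m : ℝ))⁻¹ := by
  have hn0 : (0 : ℝ) < n := by exact_mod_cast Nat.pos_of_ne_zero hn
  have eA : ∫ ω, entryFreeEnergy σ (fun p : Fin m × Fin n => A ω p.1 p.2) ∂P =
      ∫ a : Fin m × Fin n → ℝ, entryFreeEnergy σ a ∂(Measure.pi fun _ => μ) := by
    rw [← hAμ, integral_map (measurable_pi_lambda _ fun p => hA p.1 p.2).aemeasurable
      (measurable_entryFreeEnergy σ).aestronglyMeasurable]
  have eB : ∫ ω, entryFreeEnergy σ (fun p : Fin m × Fin n => B ω p.1 p.2) ∂P' =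
      ∫ a : Fin m × Fin n → ℝ, entryFreeEnergy σ a ∂(Measure.pi fun _ => ν) := by
    rw [← hBν, integral_map (measurable_pi_lambda _ fun p => hB p.1 p.2).aemeasurable
      (measurable_entryFreeEnergy σ).aestronglyMeasurable]
  simp only [capacity_eq_entryFreeEnergy hσ]
  rw [integral_sub (integrable_const _) ((integrable_entryFreeEnergy hσ hA).const_mul _),
    integral_sub (integrable_const _) ((integrable_entryFreeEnergy hσ hB).const_mul _),
    integral_const_mul, integral_const_mul, eA, eB]
  simp only [integral_const, probReal_univ, one_smul]
  have key := abs_integral_pi_sub_integral_pi_le (measurable_entryFreeEnergy σ)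
    (fun a => abs_freeEnergy_le hσ _) (mul_nonneg (cubicConst_nonneg σ) (by positivity))
    (fun a p => exists_entryFreeEnergy_taylor (m := m) (n := n) hσ a p)
    μ ν hμ3 hν3 hμ1 hν1 hμ2 hν2 hK hL
  rw [sub_sub_sub_cancel_left, ← mul_sub, abs_mul, abs_sub_comm, abs_of_nonneg (by positivity)]
  refine (mul_le_mul_of_nonneg_left key (by positivity)).trans (le_of_eq ?_)
  -- both sides vanish for `m = 0`, where `(√m)⁻¹ = 0`
  have hsq : (m : ℝ) * (√(m : ℝ))⁻¹ ^ 3 = (√(m : ℝ))⁻¹ := by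
    rcases Nat.eq_zero_or_pos m with rfl | hm
    · simp
    · have hs : 0 < √(m : ℝ) := Real.sqrt_pos.2 (by exact_mod_cast hm)
      nth_rewrite 1 [← Real.sq_sqrt (Nat.cast_nonneg m)]
      field_simp
  simp only [Fintype.card_prod, Fintype.card_fin, Nat.cast_mul]
  calc 1 / (n : ℝ) * (m * n * (cubicConst σ * (√(m : ℝ))⁻¹ ^ 3 * (K + L)))
      = (n / n : ℝ) * (cubicConst σ * (K + L) * (m * (√(m : ℝ))⁻¹ ^ 3)) := by ring
    _ = _ := by rw [hsq, div_self hn0.ne', one_mul]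

end CDMA
end

theorem theorem3
    (σ α : ℝ) (hσ : 0 < σ) (hα : 0 < α)
    (m n : ℕ → ℕ) (hn : Tendsto n atTop atTop)
    (hmn : Tendsto (fun k => (m k : ℝ) / (n k : ℝ)) atTop (𝓝 α))
    {Ω Ω' : ℕ → Type*} [∀ k, MeasurableSpace (Ω k)] [∀ k, MeasurableSpace (Ω' k)]
    (P : ∀ k, Measure (Ω k)) [∀ k, IsProbabilityMeasure (P k)]
    (P' : ∀ k, Measure (Ω' k)) [∀ k, IsProbabilityMeasure (P' k)]
    (A : ∀ k, Ω k → Matrix (Fin (m k)) (Fin (n k)) ℝ)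
    (B : ∀ k, Ω' k → Matrix (Fin (m k)) (Fin (n k)) ℝ)
    (hA : CDMA.IsStandardType P A) (hB : CDMA.IsStandardType P' B) :
    (∀ k, Integrable (fun ω => CDMA.capacity σ ((√(m k : ℝ))⁻¹ • A k ω)) (P k)) ∧
    (∀ k, Integrable (fun ω => CDMA.capacity σ ((√(m k : ℝ))⁻¹ • B k ω)) (P' k)) ∧
    Tendsto (fun k =>
        (∫ ω, CDMA.capacity σ ((√(m k : ℝ))⁻¹ • A k ω) ∂(P k)) -
          ∫ ω, CDMA.capacity σ ((√(m k : ℝ))⁻¹ • B k ω) ∂(P' k))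
      atTop (𝓝 0) := by
  refine ⟨fun k => CDMA.integrable_capacity hσ (hA.measurable k),
    fun k => CDMA.integrable_capacity hσ (hB.measurable k), ?_⟩
  obtain ⟨K, hK⟩ := hA.sixth_moment
  obtain ⟨L, hL⟩ := hB.sixth_moment
  have hnR : Tendsto (fun k => (n k : ℝ)) atTop atTop := tendsto_natCast_atTop_atTop.comp hn
  have hn0 : ∀ᶠ k in atTop, (0 : ℝ) < n k := hnR.eventually_gt_atTop 0
  have hmR : Tendsto (fun k => (m k : ℝ)) atTop atTop := by
    refine (hmn.pos_mul_atTop hα hnR).congr' ?_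
    filter_upwards [hn0] with k hk
    exact div_mul_cancel₀ _ hk.ne'
  have hlim : Tendsto (fun k => CDMA.cubicConst σ * ((1 + K) + (1 + L)) * (√(m k : ℝ))⁻¹) atTop
      (𝓝 0) := by
    simpa using ((tendsto_inv_atTop_zero.comp (Real.tendsto_sqrt_atTop.comp hmR)).const_mul
      (CDMA.cubicConst σ * ((1 + K) + (1 + L))))
  refine squeeze_zero_norm' ?_ hlim
  filter_upwards [hn0, hmR.eventually_gt_atTop 0] with k hk hmk
  have hk' : 0 < n k := by exact_mod_cast hk
  have hmk' : 0 < m k := by exact_mod_cast hmk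
  obtain ⟨μ, _, e, h3, h1, h2, hb⟩ := CDMA.exists_entry_law (⟨0, hmk'⟩, ⟨0, hk'⟩)
    (hA.measurable k) (hA.indep k) (hA.ident k) (hA.mean_zero k) (hA.second_moment k) (hK k)
  obtain ⟨ν, _, e', h3', h1', h2', hb'⟩ := CDMA.exists_entry_law (⟨0, hmk'⟩, ⟨0, hk'⟩)
    (hB.measurable k) (hB.indep k) (hB.ident k) (hB.mean_zero k) (hB.second_moment k) (hL k)
  exact CDMA.abs_integral_capacity_sub_le hσ (hA.measurable k) (hB.measurable k) e e'
    h3 h3' h1 h1' h2 h2' hb hb' hk'.ne'
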